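/- Let $1\le p<\min\{m,n\}$, let $A\in\mathbb{R}^{m\times n}$ have singular values $\sigma_1>\sigma_2>\cdots>\sigma_p>\sigma_{p+1}\ge\cdots\ge\sigma_{\min\{m,n\}}\ge 0$, let $\mu_1>\mu_2>\cdots>\mu_p>0$, $N=\mathrm{diag}(\mu_1,\dots,\mu_p)$ and $\delta>0$. On the product of Stiefel manifolds $\mathcal{M}=\mathrm{St}(p,m)\times\mathrm{St}(p,n)$, where $\mathrm{St}(p,m)=\{U\in\mathbb{R}^{m\times p}:U^{\mathsf T}U=I_p\}$, consider $f(U,V)=-\mathrm{tr}(U^{\mathsf T}AVN)$. With $\langle X,Y\rangle=\mathrm{tr}(X^{\mathsf T}Y)$ and $\mathrm{sym}(X)=\tfrac12(X+X^{\mathsf T})$, endow $\mathcal{M}$ with either the Euclidean metric $\langle\xi_1,\eta_1\rangle+\langle\xi_2,\eta_2\rangle$ or the metric $$g_{\mathrm{new},(U,V)}(\xi,\eta)=\langle\xi_1,\eta_1M_{1,2}\rangle+\langle\xi_2,\eta_2M_{2,2}\rangle,$$ $$M_{1,2}=(\mathrm{sym}(U^{\mathsf T}AVN)^2+\delta I_p)^{1/2},\qquad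 M_{2,2}=(\mathrm{sym}(V^{\mathsf T}A^{\mathsf T}UN)^2+\delta I_p)^{1/2}.$$ For a metric $g$, let $\mathrm{Hess}_g f(x)[\eta]=\nabla_\eta\,\mathrm{grad}_g f$ be the Riemannian Hessian ($\nabla$ the Levi-Civita connection of $g$), an endomorphism of the tangent space at $x$, and let $\kappa_g=\lambda_{\max}/\lambda_{\min}$ be the ratio of its largest to its smallest eigenvalue. Let the columns of $U^*$ and $V^*$ be left and right singular vectors of $A$ for $\sigma_1,\dots,\sigma_p$, i.e. $(U^*,V^*)\in\mathcal{M}$, $AV^*=U^*\Sigma$ and $A^{\mathsf T}U^*=V^*\Sigma$ with $\Sigma=\mathrm{diag}(\sigma_1,\dots,\sigma_p)$. Then both Hessians at $(U^*,V^*)$ are well defined and $$\kappa_{\mathrm e}(\mathrm{Hess}_{\mathrm e}f(U^*,V^*))=\frac{\max\left\{\frac12(\mu_1+\mu_2)(\sigma_1+\sigma_2),\ \mu_1(\sigma_1+\sigma_{p+1})\right\}}{\min\left\{\min_{i\neq j}\frac12(\mu_i-\mu_j)(\sigma_i-\sigma_j),\ \mu_p(\sigma_p-\sigma_{p+1})\right\}},$$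 $$\kappa_{\mathrm{new}}(\mathrm{Hess}_{\mathrm{new}}f(U^*,V^*))=\frac{\max\left\{\max_{i\neq j}\frac{(\mu_i+\mu_j)(\sigma_i+\sigma_j)}{\sqrt{\mu_i^2\sigma_i^2+\delta}+\sqrt{\mu_j^2\sigma_j^2+\delta}},\ \max_{i}\frac{\mu_i(\sigma_i+\sigma_{p+1})}{\sqrt{\mu_i^2\sigma_i^2+\delta}}\right\}}{\min\left\{\min_{i\neq j}\frac{(\mu_i-\mu_j)(\sigma_i-\sigma_j)}{\sqrt{\mu_i^2\sigma_i^2+\delta}+\sqrt{\mu_j^2\sigma_j^2+\delta}},\ \min_{i}\frac{\mu_i(\sigma_i-\sigma_{p+1})}{\sqrt{\mu_i^2\sigma_i^2+\delta}}\right\}},$$ where $i,j$ range over $\{1,\dots,p\}$; for $p=1$ the terms indexed by $i\neq j$ are absent and $\mu_2:=0$. Moreover, for every $\delta>0$, $$\kappa_{\mathrm{new}}(\mathrm{Hess}_{\mathrm{new}}f(U^*,V^*))\le\kappa_{\mathrm e}(\mathrm{Hess}_{\mathrm e}f(U^*,V^*)).$$ -/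

import Mathlib

open Matrix

/- The Euclidean structure on spaces of matrices is the Frobenius one. -/
attribute [local instance] Matrix.frobeniusNormedAddCommGroup Matrix.frobeniusNormedSpace

namespace TruncatedSVD

/-! ### Riemannian submanifolds of a normed space

`M : Set E` is the submanifold, `T x` its tangent space at `x ∈ M`, and `g x ξ η` a metric on `E`
whose restriction to the tangent spaces is the Riemannian metric of `M`. -/

section General

variable {E : Type*} [NormedAddCommGroup E] [NormedSpace ℝ E]

/-- On `M`, the vector field `G` is the Riemannian gradient of `f`: `G x` is the tangent vector with
`g x (G x) η = D f(x)[η]` for all tangent vectors `η`. Off `M`, `G` is arbitrary, so that `G` is an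
extension to `E` of the gradient field. -/
def IsRiemannianGradient (M : Set E) (T : E → Submodule ℝ E) (g : E → E → E → ℝ) (f : E → ℝ)
    (G : E → E) : Prop :=
  ∀ x ∈ M, G x ∈ T x ∧ ∀ η ∈ T x, g x (G x) η = fderiv ℝ f x η

/-- `g x (∇_η G) θ` for the Levi-Civita connection `∇` of the metric `g` on `E` (Koszul's formula,
for constant `η` and `θ`). For `η`, `G x`, `θ` tangent to a submanifold `M` this is
`g x (∇_η G) θ` for the Levi-Civita connection of the induced metric on `M`, which is
the tangential part of the connection of `E`. -/
noncomputable def leviCivitaForm (g : E → E → E → ℝ) (G : E → E) (x η θ : E) : ℝ :=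
  g x (fderiv ℝ G x η) θ +
    1 / 2 * (fderiv ℝ (fun y => g y (G x) θ) x η + fderiv ℝ (fun y => g y η θ) x (G x) -
      fderiv ℝ (fun y => g y η (G x)) x θ)

/-- `H` is the Riemannian Hessian `η ↦ ∇_η (grad f)` of `f` at `x`, an endomorphism of the tangent
space. The right-hand side below does not depend on the extension `G` of the gradient field, since
only derivatives of `G` along tangent vectors of `M` occur. -/
def IsRiemannianHessian (M : Set E) (T : E → Submodule ℝ E) (g : E → E → E → ℝ) (f : E → ℝ)
    (x : E) (H : Module.End ℝ (T x)) : Prop :=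
  ∃ G : E → E, IsRiemannianGradient M T g f G ∧ DifferentiableAt ℝ G x ∧
    ∀ η θ : T x, g x (H η : E) (θ : E) = leviCivitaForm g G x η θ

/-- The Riemannian Hessian operator `Hess_g f(x)`. -/
noncomputable def riemannianHessian (M : Set E) (T : E → Submodule ℝ E) (g : E → E → E → ℝ) (f : E → ℝ)
    (x : E) : Module.End ℝ (T x) :=
  Classical.epsilon (IsRiemannianHessian M T g f x)

end General

/-- The condition number `λ_max / λ_min` of an endomorphism of a real vector space: the largest
eigenvalue divided by the smallest one. -/
noncomputable def conditionNumber {V : Type*} [AddCommGroup V] [Module ℝ V] (H : Module.End ℝ V) : ℝ :=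
  sSup {c : ℝ | H.HasEigenvalue c} / sInf {c : ℝ | H.HasEigenvalue c}

/-! ### The truncated SVD problem -/

/-- The ambient space of pairs `(U, V)`. -/
abbrev Ambient (m n p : ℕ) : Type :=
  Matrix (Fin m) (Fin p) ℝ × Matrix (Fin n) (Fin p) ℝ

/-- The product `St(p, m) × St(p, n)` of Stiefel manifolds. -/
noncomputable def stiefelProd (m n p : ℕ) : Set (Ambient m n p) :=
  {x | x.1ᵀ * x.1 = 1 ∧ x.2ᵀ * x.2 = 1}

/-- The tangent space of the Stiefel manifold at `U`: all `ξ` with `Uᵀ ξ` skew-symmetric. -/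
def stiefelTangent {m p : ℕ} (U : Matrix (Fin m) (Fin p) ℝ) :
    Submodule ℝ (Matrix (Fin m) (Fin p) ℝ) where
  carrier := {ξ | Uᵀ * ξ + ξᵀ * U = 0}
  add_mem' := by
    intro a b ha hb
    simp only [Set.mem_ofPred_eq] at ha hb ⊢
    rw [transpose_add, Matrix.mul_add, Matrix.add_mul, add_add_add_comm, ha, hb, add_zero]
  zero_mem' := by simp
  smul_mem' := by
    intro c a ha
    simp only [Set.mem_ofPred_eq] at ha ⊢
    rw [transpose_smul, Matrix.mul_smul, Matrix.smul_mul, ← smul_add, ha, smul_zero]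

/-- The tangent space of `St(p, m) × St(p, n)` at `x = (U, V)`. -/
noncomputable def tangent {m n p : ℕ} (x : Ambient m n p) : Submodule ℝ (Ambient m n p) :=
  (stiefelTangent x.1).prod (stiefelTangent x.2)

/-- The cost function `f(U, V) = -tr(Uᵀ A V N)` with `N = diag(μ)`. -/
noncomputable def cost {m n p : ℕ} (A : Matrix (Fin m) (Fin n) ℝ) (μ : Fin p → ℝ) (x : Ambient m n p) : ℝ :=
  -trace (x.1ᵀ * A * x.2 * diagonal μ)

/-- The Frobenius inner product `⟨X, Y⟩ = tr(Xᵀ Y)`. -/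
noncomputable def frobInner {a b : ℕ} (X Y : Matrix (Fin a) (Fin b) ℝ) : ℝ :=
  trace (Xᵀ * Y)

/-- The symmetric part of a square matrix. -/
noncomputable def symPart {p : ℕ} (X : Matrix (Fin p) (Fin p) ℝ) : Matrix (Fin p) (Fin p) ℝ :=
  (1 / 2 : ℝ) • (X + Xᵀ)

/-- `(sym(X)² + δ I)^{1/2}`, the positive semidefinite square root being taken by applying the
function `√` to a symmetric matrix. -/
noncomputable def regAbs {p : ℕ} (δ : ℝ) (X : Matrix (Fin p) (Fin p) ℝ) : Matrix (Fin p) (Fin p) ℝ :=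
  cfc Real.sqrt (symPart X ^ 2 + δ • (1 : Matrix (Fin p) (Fin p) ℝ))

/-- The Euclidean metric `⟨ξ₁, η₁⟩ + ⟨ξ₂, η₂⟩`. -/
noncomputable def euclideanMetric {m n p : ℕ} (_x ξ η : Ambient m n p) : ℝ :=
  frobInner ξ.1 η.1 + frobInner ξ.2 η.2

/-- The right-preconditioned metric `⟨ξ₁, η₁ M₁₂⟩ + ⟨ξ₂, η₂ M₂₂⟩` at `(U, V)`, where
`M₁₂ = (sym(Uᵀ A V N)² + δ I)^{1/2}` and `M₂₂ = (sym(Vᵀ Aᵀ U N)² + δ I)^{1/2}`. -/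
noncomputable def newMetric {m n p : ℕ} (A : Matrix (Fin m) (Fin n) ℝ) (μ : Fin p → ℝ) (δ : ℝ)
    (x ξ η : Ambient m n p) : ℝ :=
  frobInner ξ.1 (η.1 * regAbs δ (x.1ᵀ * A * x.2 * diagonal μ)) +
    frobInner ξ.2 (η.2 * regAbs δ (x.2ᵀ * Aᵀ * x.1 * diagonal μ))

/-- The singular values of `A` in nonincreasing order: `sv A i` is `σ_{i+1}`. -/
noncomputable def sv {m n : ℕ} (A : Matrix (Fin m) (Fin n) ℝ) (i : ℕ) : ℝ :=
  (toEuclideanLin A).singularValues i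

/-- The columns `u₁, …, u_p` of `U` and `v₁, …, v_p` of `V` are left and right singular vectors of
`A` for its `p` largest singular values: both families are orthonormal, `A vᵢ = σᵢ uᵢ` and
`Aᵀ uᵢ = σᵢ vᵢ`. -/
def IsLeadingSingularPair {m n p : ℕ} (A : Matrix (Fin m) (Fin n) ℝ) (x : Ambient m n p) : Prop :=
  x.1ᵀ * x.1 = 1 ∧ x.2ᵀ * x.2 = 1 ∧
    A * x.2 = x.1 * diagonal (fun i : Fin p => sv A i) ∧
    Aᵀ * x.1 = x.2 * diagonal (fun i : Fin p => sv A i)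

/-- The sequence `μ`, continued by zeros: `extZero μ i` is `μ_{i+1}`, with `μ_{p+1} = 0`. -/
noncomputable def extZero {p : ℕ} (μ : Fin p → ℝ) (i : ℕ) : ℝ :=
  if h : i < p then μ ⟨i, h⟩ else 0

/-- `Hess_e f(x)`. -/
noncomputable abbrev euclideanHess {m n p : ℕ} (A : Matrix (Fin m) (Fin n) ℝ) (μ : Fin p → ℝ)
    (x : Ambient m n p) : Module.End ℝ (tangent x) :=
  riemannianHessian (stiefelProd m n p) tangent euclideanMetric (cost A μ) x

/-- `Hess_new f(x)`. -/
noncomputable abbrev newHess {m n p : ℕ} (A : Matrix (Fin m) (Fin n) ℝ) (μ : Fin p → ℝ) (δ : ℝ)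
    (x : Ambient m n p) : Module.End ℝ (tangent x) :=
  riemannianHessian (stiefelProd m n p) tangent (newMetric A μ δ) (cost A μ) x

end TruncatedSVD

/-! The pair `x` is a critical point of the cost, so the Riemannian gradient vanishes there and
every term of the Levi-Civita connection that differentiates the metric drops out. For any
continuous metric, the Hessian is therefore the endomorphism that represents, with respect to the
metric at `x`, one fixed second-order form `hessForm` (`riemannianHessian_critical`,
`riemannianHessian_cost`). Continuity of the preconditioned metric comes from a Lipschitz bound for
matrix square roots (`frobInner_sub_le`). At `x` both metrics weight the columns by a diagonal
matrix `d`, with `d = 1` or `d i = √(μ i² σ i² + δ)`, so both spectra come from the same generalised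
eigenvalue problem.

Write a tangent vector as `(U Ω₁ + K₁, V Ω₂ + K₂)` with `Ω₁`, `Ω₂` skew and `K₁`, `K₂` orthogonal to
`U`, `V`. The form decouples. Each pair `i ≠ j` gives a 2×2 block in the entries `(Ω₁ i j, Ω₂ i j)`
with eigenvalues `(μ i ± μ j)(σ i ± σ j)/(d i + d j)`. Each column `i` of `(K₁, K₂)` contributes the
extreme values `μ i (σ i ± s)/d i`, where `s` is the next singular value.
`weightedForm_add_hessForm_nonneg` bounds the Rayleigh quotient; `hasEigenvalue_rotation` and
`hasEigenvalue_next` show that the bounds are attained; `conditionNumber_eq` combines them.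

For the inequality, let `ρ` be the weighted minimum, `M` the unweighted maximum and `t = μ σ`. It is
enough to find a scale `c` such that `c ρ` is at least the unweighted minimum while `c` times every
weighted upper candidate is at most `M`. The scale is the mean weight of a minimising pair of
neighbours, or the last weight. Two facts make this work: `(μ i + μ j)(σ i + σ j) = 2 (t i + t j) -
(μ i - μ j)(σ i - σ j)`, and, after substituting `t = √δ sinh y`, `d = √δ cosh y`, the quotient `(t
i + t j)/(d i + d j)` equals `tanh ((y i + y j)/2)` (`regularized_weights_compare`,
`condition_number_le`). -/

namespace TruncatedSVD

/-! ### Riemannian Hessians at critical points of a function on a submanifold. -/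

section Abstract

open Filter Topology

variable {E : Type*} [NormedAddCommGroup E] [NormedSpace ℝ E]

/-- A product of a function vanishing at `x` and differentiable there with an operator-valued
function which is merely continuous at `x` is differentiable at `x`. -/
theorem hasFDerivAt_clm_apply_of_eq_zero {F₁ F₂ : Type*} [NormedAddCommGroup F₁] [NormedSpace ℝ F₁]
    [NormedAddCommGroup F₂] [NormedSpace ℝ F₂] {L : E → F₁ →L[ℝ] F₂} {w : E → F₁}
    {w' : E →L[ℝ] F₁} {x : E} (hL : ContinuousAt L x) (hw : HasFDerivAt w w' x) (h0 : w x = 0) :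
    HasFDerivAt (fun y => L y (w y)) ((L x).comp w') x := by
  have h1 : (fun y => (L y - L x) (w y)) =o[𝓝 x] fun y => y - x := by
    have hO : w =O[𝓝 x] fun y => y - x := by
      simpa [h0] using hw.isBigO_sub
    have ho : (fun y => L y - L x) =o[𝓝 x] fun _ => (1 : ℝ) := by
      rw [Asymptotics.isLittleO_one_iff]
      exact tendsto_sub_nhds_zero_iff.2 hL
    have := (ho.norm_left.mul_isBigO hO.norm_norm)
    refine (Asymptotics.IsBigO.of_bound 1 ?_).trans_isLittleO (this.trans_isBigO ?_)
    · filter_upwards with y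
      rw [one_mul, norm_mul, norm_norm, norm_norm]
      exact (L y - L x).le_opNorm _
    · simpa using (Asymptotics.isBigO_refl (fun y => y - x) (𝓝 x)).norm_left
  have h2 : HasFDerivAt (fun y => L x (w y)) ((L x).comp w') x := (L x).hasFDerivAt.comp x hw
  have h3 : HasFDerivAt (fun y => (L y - L x) (w y)) (0 : E →L[ℝ] F₂) x := by
    rw [hasFDerivAt_iff_isLittleO]
    simpa [h0] using h1
  have h4 := h2.add h3
  rw [add_zero] at h4
  refine h4.congr_of_eventuallyEq (Eventually.of_forall fun y => ?_)
  simp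

theorem end_eq_of_bilinear (S : Submodule ℝ E) (b : E →L[ℝ] E →L[ℝ] ℝ)
    (hb : ∀ ξ ∈ S, ξ ≠ 0 → 0 < b ξ ξ) {H H' : Module.End ℝ S}
    (h : ∀ η θ : S, b (H η) θ = b (H' η) θ) : H = H' := by
  refine LinearMap.ext fun η => ?_
  by_contra hne
  have h1 := h η (H η - H' η)
  have h2 := hb _ (H η - H' η).2 (by simpa [sub_eq_zero] using hne)
  have h3 : b ((H η - H' η : S) : E) = b (H η) - b (H' η) := by rw [Submodule.coe_sub, map_sub]
  rw [h3, _root_.sub_apply, h1, sub_self] at h2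
  exact lt_irrefl _ h2

theorem fderiv_eq_of_eq_half_bilinear (b : E →L[ℝ] E →L[ℝ] ℝ) (hb : ∀ y z, b y z = b z y)
    {f : E → ℝ} (hf : ∀ y, f y = 1 / 2 * b y y) (y : E) : fderiv ℝ f y = b y := by
  have h1 : HasFDerivAt (fun y => b y y) _ y := b.hasFDerivAt.clm_apply (hasFDerivAt_id y)
  have h2 : HasFDerivAt (fun y => 1 / 2 * b y y) _ y := h1.const_mul (1 / 2 : ℝ)
  rw [show f = fun y => 1 / 2 * b y y from funext hf, h2.fderiv]
  ext1 θ
  simp only [_root_.smul_apply, _root_.add_apply, ContinuousLinearMap.comp_apply,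
    ContinuousLinearMap.flip_apply, ContinuousLinearMap.id_apply, smul_eq_mul]
  rw [hb θ y]
  ring

variable [FiniteDimensional ℝ E]

/-- A bilinear form without nonzero isotropic vectors on a finite-dimensional space is an
isomorphism onto the dual. -/
theorem exists_equiv_of_apply_self_ne_zero (b : E →L[ℝ] E →L[ℝ] ℝ) (hb : ∀ ξ, ξ ≠ 0 → b ξ ξ ≠ 0) :
    ∃ e : E ≃L[ℝ] (E →L[ℝ] ℝ), (e : E →L[ℝ] E →L[ℝ] ℝ) = b := by
  have hinj : Function.Injective (b : E →ₗ[ℝ] E →L[ℝ] ℝ) := by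
    rw [← LinearMap.ker_eq_bot, LinearMap.ker_eq_bot']
    intro ξ h
    by_contra hne
    apply hb ξ hne
    have : b ξ = 0 := h
    simp [this]
  have hfr : Module.finrank ℝ E = Module.finrank ℝ (E →L[ℝ] ℝ) := by
    rw [← (LinearMap.toContinuousLinearMap (𝕜 := ℝ) (E := E) (F' := ℝ)).finrank_eq]
    exact Subspace.dual_finrank_eq.symm
  refine ⟨(LinearMap.linearEquivOfInjective _ hinj hfr).toContinuousLinearEquiv, ?_⟩
  ext ξ θ
  simp

variable {M : Set E} {T : E → Submodule ℝ E}

/-- A bilinear form positive on a subspace represents every bilinear form on that subspace. -/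
theorem exists_end_of_bilinear (S : Submodule ℝ E) (b B : E →L[ℝ] E →L[ℝ] ℝ)
    (hb : ∀ ξ ∈ S, ξ ≠ 0 → 0 < b ξ ξ) :
    ∃ H : Module.End ℝ S, ∀ η θ : S, b (H η) θ = B η θ := by
  let bS : S →L[ℝ] S →L[ℝ] ℝ := b.bilinearComp S.subtypeL S.subtypeL
  let BS : S →L[ℝ] S →L[ℝ] ℝ := B.bilinearComp S.subtypeL S.subtypeL
  obtain ⟨e, he⟩ := exists_equiv_of_apply_self_ne_zero bS (fun ξ hξ => by
    have := hb ξ ξ.2 (by simpa using hξ)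
    simpa [bS] using this.ne')
  refine ⟨(e.symm.toLinearMap).comp BS.toLinearMap, fun η θ => ?_⟩
  have h : bS (e.symm (BS η)) = BS η := by
    rw [← he]; simp
  have := congrArg (fun l => l θ) h
  simpa [bS, BS] using this

/-- At a critical point, the Riemannian Hessian exists, is unique, and is determined by the
derivative of `y ↦ D f(y) ∘ Q y`, where `Q y` projects onto the tangent space at `y`. The metric
only has to be continuous at the critical point. -/
theorem riemannianHessian_critical {g : E → E →L[ℝ] E →L[ℝ] ℝ} {e : E →L[ℝ] E →L[ℝ] ℝ}
    {Q : E → E →L[ℝ] E} {f : E → ℝ} {x : E} {B : E →L[ℝ] E →L[ℝ] ℝ}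
    (hx : x ∈ M) (he : ∀ ξ, ξ ≠ 0 → 0 < e ξ ξ)
    (hQ : ∀ y ∈ M, ∀ ξ, Q y ξ ∈ T y) (hQT : ∀ y ∈ M, ∀ ξ ∈ T y, Q y ξ = ξ)
    (hQc : ContinuousAt Q x)
    (hg : ∀ y ∈ M, ∀ ξ ∈ T y, ξ ≠ 0 → 0 < g y ξ ξ) (hgc : ContinuousAt g x)
    (hf : HasFDerivAt (fun y => (fderiv ℝ f y).comp (Q y)) B x)
    (hcrit : ∀ θ ∈ T x, fderiv ℝ f x θ = 0)
    (hcurve : ∀ η ∈ T x, ∃ c : ℝ → E, c 0 = x ∧ HasDerivAt c η 0 ∧ ∀ t, c t ∈ M) :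
    (∃! H, IsRiemannianHessian M T (fun y ξ θ => g y ξ θ) f x H) ∧
      ∀ η θ : T x, g x (riemannianHessian M T (fun y ξ θ => g y ξ θ) f x η) θ = B η θ := by
  have hlc : ∀ G : E → E, IsRiemannianGradient M T (fun y ξ θ => g y ξ θ) f G →
      DifferentiableAt ℝ G x → ∀ η θ : T x,
      leviCivitaForm (fun y ξ θ => g y ξ θ) G x η θ = B η θ := by
    intro G hG hGd η θ
    have hG0 : G x = 0 := by
      by_contra hne
      have h1 := hg x hx _ (hG x hx).1 hne
      have h2 := (hG x hx).2 _ (hG x hx).1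
      rw [hcrit _ (hG x hx).1] at h2
      exact h1.ne' h2
    obtain ⟨c, hc0, hc, hcM⟩ := hcurve η η.2
    -- All three Koszul corrections vanish because `G x = 0`: two have a zero slot in the metric,
    -- one is a derivative in a zero direction.
    have hl : leviCivitaForm (fun y ξ θ => g y ξ θ) G x η θ = g x (fderiv ℝ G x η) θ := by
      simp [leviCivitaForm, hG0]
    rw [hl]
    subst hc0
    -- both sides are the derivative at `0` of `t ↦ D f(c t) (Q (c t) θ)`
    have hR : HasDerivAt (fun t => (fderiv ℝ f (c t)).comp (Q (c t)) (θ : E)) (B η θ) 0 := by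
      have h1 : HasDerivAt (fun t => (fderiv ℝ f (c t)).comp (Q (c t))) (B η) 0 :=
        hf.comp_hasDerivAt 0 hc
      simpa using h1.clm_apply (hasDerivAt_const (0 : ℝ) (θ : E))
    have hcd : HasFDerivAt c (ContinuousLinearMap.toSpanSingleton ℝ (η : E)) 0 := hc.hasFDerivAt
    have hw : HasFDerivAt (fun t => G (c t))
        ((fderiv ℝ G (c 0)).comp (ContinuousLinearMap.toSpanSingleton ℝ (η : E))) 0 :=
      hGd.hasFDerivAt.comp (0 : ℝ) hcd
    have hLc : ContinuousAt (fun y => (g y).flip (Q y θ)) (c 0) := by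
      have h1 : ContinuousAt (fun y => (g y).flip) (c 0) :=
        ((ContinuousLinearMap.flipₗᵢ ℝ E E ℝ).continuous.continuousAt).comp hgc
      exact h1.clm_apply (hQc.clm_apply continuousAt_const)
    have hL : HasFDerivAt (fun t => (g (c t)).flip (Q (c t) θ) (G (c t))) _ 0 :=
      hasFDerivAt_clm_apply_of_eq_zero (L := fun t => (g (c t)).flip (Q (c t) θ))
        (ContinuousAt.comp (f := c) hLc hc.continuousAt) hw hG0
    -- `Q (c t) θ` is tangent at `c t`, so the defining property of the gradient applies along the
    -- whole curve.
    have hfun : (fun t => (g (c t)).flip (Q (c t) θ) (G (c t))) =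
        fun t => (fderiv ℝ f (c t)).comp (Q (c t)) (θ : E) := by
      funext t
      exact (hG _ (hcM t)).2 _ (hQ _ (hcM t) _)
    rw [hfun] at hL
    have := hL.hasDerivAt.unique hR
    simpa [hQT _ hx θ θ.2] using this
  -- the gradient field
  let b : E → E →L[ℝ] E →L[ℝ] ℝ := fun y =>
    (g y).bilinearComp (Q y) (Q y) +
      e.bilinearComp (ContinuousLinearMap.id ℝ E - Q y) (ContinuousLinearMap.id ℝ E - Q y)
  have hb_apply : ∀ y ξ θ, b y ξ θ = g y (Q y ξ) (Q y θ) + e (ξ - Q y ξ) (θ - Q y θ) := by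
    intro y ξ θ; simp [b]
  have hb_ne : ∀ y ∈ M, ∀ ξ, ξ ≠ 0 → b y ξ ξ ≠ 0 := by
    intro y hy ξ hξ
    rw [hb_apply]
    by_cases h1 : Q y ξ = 0
    · simpa [h1] using (he ξ hξ).ne'
    · have h2 := hg y hy _ (hQ y hy ξ) h1
      by_cases h3 : ξ - Q y ξ = 0
      · simpa [h3] using h2.ne'
      · exact (add_pos h2 (he _ h3)).ne'
  have hbc : ContinuousAt b x := by
    refine (continuousAt_clm_apply).2 fun ξ => (continuousAt_clm_apply).2 fun θ => ?_
    simp only [hb_apply]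
    have h1 : ∀ ξ, ContinuousAt (fun y => Q y ξ) x := fun ξ => hQc.clm_apply continuousAt_const
    exact ((hgc.clm_apply (h1 ξ)).clm_apply (h1 θ)).add
      ((continuousAt_const.clm_apply (continuousAt_const.sub (h1 ξ))).clm_apply
        (continuousAt_const.sub (h1 θ)))
  -- Off `M` the form `b y` may be singular and `inverse` is then zero. This is harmless: `b x` is
  -- invertible and inversion is continuous there.
  let G : E → E := fun y => (b y).inverse ((fderiv ℝ f y).comp (Q y))
  have hG : IsRiemannianGradient M T (fun y ξ θ => g y ξ θ) f G := by
    intro y hy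
    obtain ⟨eq, heq⟩ := exists_equiv_of_apply_self_ne_zero (b y) (hb_ne y hy)
    have hGy : ∀ θ, b y (G y) θ = fderiv ℝ f y (Q y θ) := by
      intro θ
      have : b y (G y) = (fderiv ℝ f y).comp (Q y) := by
        simp only [G]
        rw [← heq, ContinuousLinearMap.inverse_equiv]
        simp
      rw [this]; rfl
    -- Testing the equation against the normal part of `G y` kills both the metric term and the
    -- right-hand side, leaving `e` of that part with itself.
    have hQG : Q y (G y) = G y := by
      by_contra hne
      have h1 : G y - Q y (G y) ≠ 0 := fun h => hne (sub_eq_zero.1 h).symm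
      have h2 := hGy (G y - Q y (G y))
      have h3 : Q y (G y - Q y (G y)) = 0 := by
        rw [map_sub, hQT y hy _ (hQ y hy _), sub_self]
      rw [hb_apply, h3, map_zero, zero_add, sub_zero, map_zero] at h2
      exact (he _ h1).ne' h2
    refine ⟨hQG ▸ hQ y hy _, fun η hη => ?_⟩
    have h := hGy η
    rw [hb_apply, hQG, hQT y hy η hη, sub_self, sub_self, map_zero, add_zero] at h
    exact h
  have hGd : DifferentiableAt ℝ G x := by
    obtain ⟨eq, heq⟩ := exists_equiv_of_apply_self_ne_zero (b x) (hb_ne x hx)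
    have hinv : ContinuousAt (fun y => (b y).inverse) x := by
      have h1 : ContinuousAt ContinuousLinearMap.inverse (b x) := by
        rw [← heq]
        exact (contDiffAt_map_inverse (n := 0) eq).continuousAt
      exact ContinuousAt.comp (f := b) h1 hbc
    refine (hasFDerivAt_clm_apply_of_eq_zero hinv hf ?_).differentiableAt
    ext θ
    exact hcrit _ (hQ x hx θ)
  obtain ⟨H, hH⟩ := exists_end_of_bilinear (T x) (g x) B (hg x hx)
  have hHH : IsRiemannianHessian M T (fun y ξ θ => g y ξ θ) f x H :=
    ⟨G, hG, hGd, fun η θ => (hH η θ).trans (hlc G hG hGd η θ).symm⟩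
  refine ⟨⟨H, hHH, ?_⟩, ?_⟩
  · rintro H' ⟨G', hG', hGd', h'⟩
    refine end_eq_of_bilinear (T x) (g x) (hg x hx) fun η θ => ?_
    rw [hH]
    exact (h' η θ).trans (hlc G' hG' hGd' η θ)
  · obtain ⟨G', hG', hGd', h'⟩ := Classical.epsilon_spec (p := IsRiemannianHessian M T
      (fun y ξ θ => g y ξ θ) f x) ⟨H, hHH⟩
    intro η θ
    exact (h' η θ).trans (hlc G' hG' hGd' η θ)

/-- `riemannianHessian_critical` for a quadratic function on a submanifold whose tangential
projections have the form `θ ↦ θ - R θ y y` with `R θ` bilinear. -/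
theorem riemannianHessian_critical_of_quadratic {g : E → E →ₗ[ℝ] E →ₗ[ℝ] ℝ}
    {e D : E →ₗ[ℝ] E →ₗ[ℝ] ℝ} {Q : E → E →ₗ[ℝ] E} {R : E → E →ₗ[ℝ] E →ₗ[ℝ] E} {f : E → ℝ} {x : E}
    (hx : x ∈ M) (he : ∀ ξ, ξ ≠ 0 → 0 < e ξ ξ)
    (hD : ∀ y z, D y z = D z y) (hf : ∀ y, f y = 1 / 2 * D y y)
    (hQR : ∀ y θ, Q y θ = θ - R θ y y)
    (hQ : ∀ y ∈ M, ∀ ξ, Q y ξ ∈ T y) (hRT : ∀ y ∈ M, ∀ θ ∈ T y, ∀ z, R θ z y = 0)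
    (hg : ∀ y ∈ M, ∀ ξ ∈ T y, ξ ≠ 0 → 0 < g y ξ ξ)
    (hgc : ∀ ξ θ, ContinuousAt (fun y => g y ξ θ) x)
    (hcrit : ∀ θ ∈ T x, D x θ = 0)
    (hcurve : ∀ η ∈ T x, ∃ c : ℝ → E, c 0 = x ∧ HasDerivAt c η 0 ∧ ∀ t, c t ∈ M) :
    (∃! H, IsRiemannianHessian M T (fun y ξ θ => g y ξ θ) f x H) ∧
      ∀ η θ : T x, g x (riemannianHessian M T (fun y ξ θ => g y ξ θ) f x η) θ =
        D η θ - D x (R θ x η) := by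
  let D' : E →L[ℝ] E →L[ℝ] ℝ := D.toContinuousBilinearMap
  let g' : E → E →L[ℝ] E →L[ℝ] ℝ := fun y => (g y).toContinuousBilinearMap
  let R' : E → E →L[ℝ] E →L[ℝ] E := fun θ => (R θ).toContinuousBilinearMap
  let Q' : E → E →L[ℝ] E := fun y => (Q y).toContinuousLinearMap
  have hQ' : ∀ y θ, Q' y θ = θ - R' θ y y := hQR
  have hfd : ∀ y, fderiv ℝ f y = D' y := fderiv_eq_of_eq_half_bilinear D' hD hf
  have hQc : Continuous Q' := by
    rw [continuous_clm_apply]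
    intro θ
    simp only [hQ']
    fun_prop
  have hg'c : ContinuousAt g' x :=
    continuousAt_clm_apply.2 fun ξ => continuousAt_clm_apply.2 fun θ => hgc ξ θ
  have hd : Differentiable ℝ fun y => (D' y).comp (Q' y) := by
    refine ContDiff.differentiable (n := 1) ?_ one_ne_zero
    rw [contDiff_clm_apply_iff]
    intro θ
    simp only [ContinuousLinearMap.comp_apply, hQ']
    fun_prop
  have hB : ∀ η, ∀ θ ∈ T x,
      fderiv ℝ (fun y => (D' y).comp (Q' y)) x η θ = D' η θ - D' x (R' θ x η) := by
    intro η θ hθ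
    -- The derivative of `R θ y y` at `x` along `η` is `R θ η x + R θ x η`; for tangent `θ` the
    -- first term vanishes.
    have hR0 : ∀ z, R' θ z x = 0 := hRT x hx θ hθ
    have hL : HasFDerivAt (fun y => D' y (θ - R' θ y y)) _ x :=
      D'.hasFDerivAt.clm_apply ((hasFDerivAt_const θ x).sub
        ((R' θ).hasFDerivAt.clm_apply (hasFDerivAt_id x)))
    have hL' : HasFDerivAt (fun y => (D' y).comp (Q' y) θ) _ x :=
      (hd x).hasFDerivAt.clm_apply (hasFDerivAt_const θ x)
    simp only [ContinuousLinearMap.comp_apply, hQ'] at hL'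
    have := congrArg (fun l => l η) (hL'.unique hL)
    simp [hR0] at this
    rw [this]
    ring
  have key := riemannianHessian_critical (g := g') (e := e.toContinuousBilinearMap) (Q := Q')
    (f := f) (T := T) (B := fderiv ℝ (fun y => (D' y).comp (Q' y)) x) hx he hQ
    (fun y hy θ hθ => by rw [hQ' y θ, show R' θ y y = 0 from hRT y hy θ hθ y, sub_zero])
    hQc.continuousAt hg hg'c (by simpa only [hfd] using (hd x).hasFDerivAt)
    (fun θ hθ => by rw [hfd]; exact hcrit θ hθ) hcurve
  exact ⟨key.1, fun η θ => (key.2 η θ).trans (hB _ _ θ.2)⟩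

end Abstract

/-! ### The Frobenius inner product. -/

section FrobInner

variable {a b : ℕ}

theorem frobInner_eq_sum (X Y : Matrix (Fin a) (Fin b) ℝ) :
    frobInner X Y = ∑ j, ∑ i, X i j * Y i j := by
  simp [frobInner, trace, mul_apply]

theorem frobInner_self_nonneg (X : Matrix (Fin a) (Fin b) ℝ) : 0 ≤ frobInner X X := by
  rw [frobInner_eq_sum]
  exact Finset.sum_nonneg fun j _ => Finset.sum_nonneg fun i _ => mul_self_nonneg _

theorem sq_apply_le_frobInner_self (X : Matrix (Fin a) (Fin b) ℝ) (i : Fin a) (j : Fin b) :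
    X i j ^ 2 ≤ frobInner X X := by
  rw [frobInner_eq_sum, sq]
  refine le_trans (Finset.single_le_sum (f := fun i => X i j * X i j)
    (fun i _ => mul_self_nonneg _) (Finset.mem_univ i)) ?_
  exact Finset.single_le_sum (f := fun j => ∑ i, X i j * X i j)
    (fun j _ => Finset.sum_nonneg fun i _ => mul_self_nonneg _) (Finset.mem_univ j)

theorem frobInner_self_pos {X : Matrix (Fin a) (Fin b) ℝ} (hX : X ≠ 0) : 0 < frobInner X X := by
  refine lt_of_le_of_ne (frobInner_self_nonneg X) fun h => hX ?_
  ext i j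
  have := sq_apply_le_frobInner_self X i j
  rw [← h] at this
  simpa using this

theorem frobInner_add_left (X X' Y : Matrix (Fin a) (Fin b) ℝ) :
    frobInner (X + X') Y = frobInner X Y + frobInner X' Y := by
  simp [frobInner, Matrix.add_mul]

theorem frobInner_add_right (X Y Y' : Matrix (Fin a) (Fin b) ℝ) :
    frobInner X (Y + Y') = frobInner X Y + frobInner X Y' := by
  simp [frobInner, Matrix.mul_add]

theorem frobInner_sub_left (X X' Y : Matrix (Fin a) (Fin b) ℝ) :
    frobInner (X - X') Y = frobInner X Y - frobInner X' Y := by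
  simp [frobInner, Matrix.sub_mul]

theorem frobInner_sub_right (X Y Y' : Matrix (Fin a) (Fin b) ℝ) :
    frobInner X (Y - Y') = frobInner X Y - frobInner X Y' := by
  simp [frobInner, Matrix.mul_sub]

theorem frobInner_smul_left (c : ℝ) (X Y : Matrix (Fin a) (Fin b) ℝ) :
    frobInner (c • X) Y = c * frobInner X Y := by
  simp [frobInner]

theorem frobInner_smul_right (c : ℝ) (X Y : Matrix (Fin a) (Fin b) ℝ) :
    frobInner X (c • Y) = c * frobInner X Y := by
  simp [frobInner]

theorem frobInner_comm (X Y : Matrix (Fin a) (Fin b) ℝ) : frobInner X Y = frobInner Y X := by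
  simp only [frobInner_eq_sum, mul_comm]

theorem frobInner_transpose (X Y : Matrix (Fin a) (Fin b) ℝ) :
    frobInner Xᵀ Yᵀ = frobInner X Y := by
  simp only [frobInner_eq_sum, transpose_apply]
  exact Finset.sum_comm

theorem frobInner_mul_left {c : ℕ} (Z : Matrix (Fin a) (Fin c) ℝ) (X : Matrix (Fin c) (Fin b) ℝ)
    (Y : Matrix (Fin a) (Fin b) ℝ) : frobInner (Z * X) Y = frobInner X (Zᵀ * Y) := by
  simp [frobInner, Matrix.mul_assoc]

theorem frobInner_mul_right {c : ℕ} (Z : Matrix (Fin a) (Fin c) ℝ) (X : Matrix (Fin c) (Fin b) ℝ)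
    (Y : Matrix (Fin a) (Fin b) ℝ) : frobInner (Z * X) Y = frobInner Z (Y * Xᵀ) := by
  rw [frobInner, frobInner, transpose_mul, Matrix.mul_assoc, trace_mul_comm, Matrix.mul_assoc]

end FrobInner

/-! ### The regularised absolute value of a symmetric matrix, its uniqueness and continuity. -/

section RegAbs

variable {p : ℕ} {δ : ℝ}

theorem symPart_transpose (X : Matrix (Fin p) (Fin p) ℝ) : (symPart X)ᵀ = symPart X := by
  simp [symPart, add_comm]

theorem regAbs_eq_cfc (X : Matrix (Fin p) (Fin p) ℝ) :
    regAbs δ X = cfc (fun t : ℝ => √(t ^ 2 + δ)) (symPart X) := by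
  have hX : IsSelfAdjoint (symPart X) := by
    rw [IsSelfAdjoint, star_eq_conjTranspose, conjTranspose_eq_transpose_of_trivial,
      symPart_transpose]
  have h1 : cfc (fun t : ℝ => t ^ 2 + δ) (symPart X) = symPart X ^ 2 + δ • 1 := by
    rw [cfc_add_const _ _ _ (by fun_prop) hX, cfc_pow_id _ _ hX, Algebra.algebraMap_eq_smul_one]
  rw [regAbs, ← h1, ← cfc_comp' Real.sqrt (fun t : ℝ => t ^ 2 + δ) (symPart X)
    (by fun_prop) (by fun_prop) hX]

theorem regAbs_mul_self (hδ : 0 < δ) (X : Matrix (Fin p) (Fin p) ℝ) :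
    regAbs δ X * regAbs δ X = symPart X ^ 2 + δ • 1 := by
  have hX : IsSelfAdjoint (symPart X) := by
    rw [IsSelfAdjoint, star_eq_conjTranspose, conjTranspose_eq_transpose_of_trivial,
      symPart_transpose]
  have h1 : cfc (fun t : ℝ => t ^ 2 + δ) (symPart X) = symPart X ^ 2 + δ • 1 := by
    rw [cfc_add_const _ _ _ (by fun_prop) hX, cfc_pow_id _ _ hX, Algebra.algebraMap_eq_smul_one]
  rw [regAbs_eq_cfc, ← cfc_mul _ _ _ (by fun_prop) (by fun_prop), ← h1]
  refine cfc_congr fun t _ => ?_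
  exact Real.mul_self_sqrt (by positivity)

/-- This encodes the lower bound `√δ` on the spectrum as an exact square, so that later positivity
arguments reduce to `frobInner_self_nonneg`. The matrix `R` is the square root of `√(t² + δ) - √δ ≥
0` in the functional calculus. -/
theorem regAbs_eq_add_sq (δ : ℝ) (X : Matrix (Fin p) (Fin p) ℝ) :
    ∃ R : Matrix (Fin p) (Fin p) ℝ, Rᵀ = R ∧ regAbs δ X = √δ • 1 + R * R := by
  have hX : IsSelfAdjoint (symPart X) := by
    rw [IsSelfAdjoint, star_eq_conjTranspose, conjTranspose_eq_transpose_of_trivial,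
      symPart_transpose]
  refine ⟨cfc (fun t : ℝ => √(√(t ^ 2 + δ) - √δ)) (symPart X), ?_, ?_⟩
  · have h := cfc_predicate (fun t : ℝ => √(√(t ^ 2 + δ) - √δ)) (symPart X)
    rwa [IsSelfAdjoint, star_eq_conjTranspose, conjTranspose_eq_transpose_of_trivial] at h
  · rw [regAbs_eq_cfc, ← cfc_mul _ _ _ (by fun_prop) (by fun_prop),
      ← Algebra.algebraMap_eq_smul_one, ← cfc_const_add _ _ _ (by fun_prop) hX]
    refine cfc_congr fun t _ => ?_
    have : √δ ≤ √(t ^ 2 + δ) := Real.sqrt_le_sqrt (by nlinarith [sq_nonneg t])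
    rw [Real.mul_self_sqrt (by linarith)]
    ring

/-- Square roots of positive definite matrices depend on the matrix in a Lipschitz way. -/
theorem frobInner_sub_le {c : ℝ} (hc : 0 < c) {S S' R R' : Matrix (Fin p) (Fin p) ℝ}
    (hR : Rᵀ = R) (hR' : R'ᵀ = R') (hS : S = c • 1 + R * R) (hS' : S' = c • 1 + R' * R') :
    c ^ 2 * frobInner (S - S') (S - S') ≤
      frobInner (S * S - S' * S') (S * S - S' * S') := by
  set D := S - S' with hD
  set P := S * S - S' * S' with hP
  -- With the Sylvester identity `P = S D + D S'`, each factor contributes `c` times the squared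
  -- norm of `D` plus a square.
  have h1 : frobInner D P =
      2 * c * frobInner D D + frobInner (R * D) (R * D) + frobInner (D * R') (D * R') := by
    have h2 : P = S * D + D * S' := by simp only [hP, hD]; noncomm_ring
    rw [h2, frobInner_add_right, hS, hS', Matrix.add_mul, Matrix.mul_add, frobInner_add_right,
      frobInner_add_right, frobInner_mul_left R, frobInner_mul_right D, hR, hR']
    simp only [Matrix.smul_mul, Matrix.one_mul, Matrix.mul_smul, Matrix.mul_one, frobInner_smul_right, Matrix.mul_assoc]
    ring
  have h3 := frobInner_self_nonneg (R * D)
  have h4 := frobInner_self_nonneg (D * R')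
  -- This replaces Cauchy–Schwarz: `‖P‖² ≥ 2c⟨D, P⟩ - c²‖D‖²`, and `⟨D, P⟩ ≥ 2c‖D‖²` by `h1`.
  have h5 := frobInner_self_nonneg (c • D - P)
  simp only [frobInner_sub_left, frobInner_sub_right, frobInner_smul_left,
    frobInner_smul_right, frobInner_comm P D] at h5
  have h6 := frobInner_self_nonneg D
  nlinarith

/-- Squaring is injective on symmetric matrices bounded below by `√δ`, by the Lipschitz bound
`frobInner_sub_le`. This permits evaluating `regAbs` without computing a functional calculus. -/
theorem regAbs_unique (hδ : 0 < δ) {X S R : Matrix (Fin p) (Fin p) ℝ} (hR : Rᵀ = R)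
    (hS : S = √δ • 1 + R * R) (h : S * S = symPart X ^ 2 + δ • 1) : regAbs δ X = S := by
  obtain ⟨R', hR', h'⟩ := regAbs_eq_add_sq δ X
  have h1 := frobInner_sub_le (Real.sqrt_pos.2 hδ) hR' hR h' hS
  rw [regAbs_mul_self hδ, h, sub_self] at h1
  by_contra hne
  have h2 := frobInner_self_pos (sub_ne_zero.2 hne)
  rw [Real.sq_sqrt hδ.le] at h1
  have h3 : frobInner (0 : Matrix (Fin p) (Fin p) ℝ) 0 = 0 := by simp [frobInner]
  rw [h3] at h1
  nlinarith

theorem regAbs_diagonal (hδ : 0 < δ) (d : Fin p → ℝ) :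
    regAbs δ (diagonal d) = diagonal fun i => √(d i ^ 2 + δ) := by
  refine regAbs_unique (R := diagonal fun i => √(√(d i ^ 2 + δ) - √δ)) hδ (by simp) ?_ ?_
  · rw [diagonal_mul_diagonal, smul_one_eq_diagonal, diagonal_add]
    congr 1
    funext i
    have : √δ ≤ √(d i ^ 2 + δ) := Real.sqrt_le_sqrt (by nlinarith [sq_nonneg (d i)])
    rw [Real.mul_self_sqrt (by linarith)]
    ring
  · have h1 : symPart (diagonal d) = diagonal d := by
      simp only [symPart, diagonal_transpose, diagonal_add]
      ext i j
      by_cases h : i = j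
      · subst h; simp; ring
      · simp [h]
    rw [h1, diagonal_mul_diagonal, smul_one_eq_diagonal, diagonal_pow, diagonal_add]
    congr 1
    funext i
    rw [Real.mul_self_sqrt (by positivity)]
    simp

/-- Each entry of the difference is squeezed by the Lipschitz bound: its square is at most `δ⁻¹`
times the squared norm of the difference of the squared matrices, which is polynomial in the
entries. -/
theorem continuous_regAbs (hδ : 0 < δ) :
    Continuous (regAbs δ : Matrix (Fin p) (Fin p) ℝ → Matrix (Fin p) (Fin p) ℝ) := by
  rw [continuous_iff_continuousAt]
  intro X
  let P : Matrix (Fin p) (Fin p) ℝ → Matrix (Fin p) (Fin p) ℝ := fun Y =>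
    (symPart Y ^ 2 + δ • 1) - (symPart X ^ 2 + δ • 1)
  have hP : Continuous P := by
    simp only [P, symPart]
    fun_prop
  have hF : Continuous fun Y => δ⁻¹ * frobInner (P Y) (P Y) := by
    simp only [frobInner]
    exact continuous_const.mul
      ((hP.matrix_transpose.matrix_mul hP).matrix_trace)
  have hlim : Filter.Tendsto (fun Y => δ⁻¹ * frobInner (P Y) (P Y)) (nhds X) (nhds 0) := by
    have := hF.tendsto X
    simpa [P, frobInner] using this
  refine tendsto_pi_nhds.2 fun i => tendsto_pi_nhds.2 fun j => ?_
  refine tendsto_sub_nhds_zero_iff.1 ((tendsto_zero_iff_abs_tendsto_zero _).2 ?_)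
  have hs : Filter.Tendsto (fun Y => (regAbs δ Y i j - regAbs δ X i j) ^ 2) (nhds X) (nhds 0) := by
    refine squeeze_zero (fun Y => sq_nonneg _) (fun Y => ?_) hlim
    obtain ⟨R, hR, h⟩ := regAbs_eq_add_sq δ Y
    obtain ⟨R', hR', h'⟩ := regAbs_eq_add_sq δ X
    have h1 := frobInner_sub_le (Real.sqrt_pos.2 hδ) hR hR' h h'
    rw [regAbs_mul_self hδ, regAbs_mul_self hδ, Real.sq_sqrt hδ.le] at h1
    rw [inv_mul_eq_div, le_div_iff₀ hδ, mul_comm]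
    refine le_trans (mul_le_mul_of_nonneg_left ?_ hδ.le) h1
    exact sq_apply_le_frobInner_self (regAbs δ Y - regAbs δ X) i j
  have := hs.sqrt
  simp only [Real.sqrt_sq_eq_abs, Real.sqrt_zero] at this
  exact this

theorem frobInner_mul_regAbs_pos {a : ℕ} (hδ : 0 < δ) (X : Matrix (Fin p) (Fin p) ℝ)
    {ξ : Matrix (Fin a) (Fin p) ℝ} (hξ : ξ ≠ 0) : 0 < frobInner ξ (ξ * regAbs δ X) := by
  obtain ⟨R, hR, h⟩ := regAbs_eq_add_sq δ X
  have h1 : frobInner ξ (ξ * regAbs δ X) =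
      √δ * frobInner ξ ξ + frobInner (ξ * R) (ξ * R) := by
    rw [h, frobInner_mul_right ξ R, hR, Matrix.mul_add, frobInner_add_right]
    simp [frobInner_smul_right, Matrix.mul_assoc]
  rw [h1]
  have := frobInner_self_pos hξ
  have := frobInner_self_nonneg (ξ * R)
  have := Real.sqrt_pos.2 hδ
  positivity

end RegAbs

/-! ### Stiefel geometry and the Hessian of the cost. -/

section Stiefel

section Curve

attribute [local instance] Matrix.frobeniusNormedRing Matrix.frobeniusNormedAlgebra

theorem hasDerivAt_exp_smul_mul {m p : ℕ} (W : Matrix (Fin m) (Fin m) ℝ)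
    (U : Matrix (Fin m) (Fin p) ℝ) :
    HasDerivAt (fun t : ℝ => NormedSpace.exp (t • W) * U) (W * U) 0 := by
  have h1 : HasDerivAt (fun t : ℝ => NormedSpace.exp (t • W)) W 0 := by
    have h := hasDerivAt_exp_smul_const W (0 : ℝ)
    rw [zero_smul, NormedSpace.exp_zero, one_mul] at h
    exact h
  let L : Matrix (Fin m) (Fin m) ℝ →L[ℝ] Matrix (Fin m) (Fin p) ℝ :=
    LinearMap.toContinuousLinearMap (mulRightLinearMap (Fin m) ℝ U)
  exact L.hasFDerivAt.comp_hasDerivAt 0 h1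

end Curve

/-- Every tangent vector of the Stiefel manifold is the velocity of a curve `t ↦ exp(tW) U`. -/
theorem exists_stiefel_curve {m p : ℕ} {U ξ : Matrix (Fin m) (Fin p) ℝ} (hU : Uᵀ * U = 1)
    (hξ : ξ ∈ stiefelTangent U) :
    ∃ c : ℝ → Matrix (Fin m) (Fin p) ℝ, c 0 = U ∧ HasDerivAt c ξ 0 ∧ ∀ t, (c t)ᵀ * c t = 1 := by
  have hξ' : ξᵀ * U = -(Uᵀ * ξ) := by
    have : Uᵀ * ξ + ξᵀ * U = 0 := hξ
    exact eq_neg_of_add_eq_zero_right this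
  -- `ξ Uᵀ - U ξᵀ` is skew, but sends `U` to `ξ + U (Uᵀ ξ)`. The third term, also skew, removes the
  -- excess.
  set W := ξ * Uᵀ - U * ξᵀ - U * (Uᵀ * ξ) * Uᵀ with hW
  have hWU : W * U = ξ := by
    rw [hW, Matrix.sub_mul, Matrix.sub_mul, Matrix.mul_assoc ξ, Matrix.mul_assoc U ξᵀ,
      Matrix.mul_assoc _ Uᵀ U, hU, hξ']
    simp
  have hWt : Wᵀ = -W := by
    have h1 : (Uᵀ * ξ)ᵀ = -(Uᵀ * ξ) := by rw [transpose_mul, transpose_transpose, hξ']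
    rw [hW]
    simp only [transpose_sub, transpose_mul, transpose_transpose]
    rw [hξ']
    simp only [Matrix.mul_assoc, Matrix.neg_mul, Matrix.mul_neg]
    abel
  refine ⟨fun t => NormedSpace.exp (t • W) * U, by simp, ?_, fun t => ?_⟩
  · have := hasDerivAt_exp_smul_mul W U
    rwa [hWU] at this
  · have h1 : (NormedSpace.exp (t • W))ᵀ * NormedSpace.exp (t • W) = 1 := by
      rw [← exp_transpose, transpose_smul, hWt, smul_neg, exp_neg, Matrix.nonsing_inv_mul]
      exact (isUnit_iff_isUnit_det _).1 (Matrix.isUnit_exp _)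
    rw [transpose_mul, Matrix.mul_assoc, ← Matrix.mul_assoc _ (NormedSpace.exp (t • W)) U, h1,
      Matrix.one_mul, hU]

variable {m n p : ℕ}

theorem symPart_add (X Y : Matrix (Fin p) (Fin p) ℝ) :
    symPart (X + Y) = symPart X + symPart Y := by
  simp only [symPart, transpose_add, ← smul_add]
  congr 1
  abel

theorem symPart_smul (c : ℝ) (X : Matrix (Fin p) (Fin p) ℝ) :
    symPart (c • X) = c • symPart X := by
  simp only [symPart, transpose_smul, ← smul_add, smul_comm c]

theorem mem_stiefelTangent {U ξ : Matrix (Fin m) (Fin p) ℝ} :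
    ξ ∈ stiefelTangent U ↔ Uᵀ * ξ + ξᵀ * U = 0 := Iff.rfl

theorem symPart_eq_zero_of_mem {U ξ : Matrix (Fin m) (Fin p) ℝ} (h : ξ ∈ stiefelTangent U) :
    symPart (Uᵀ * ξ) = 0 := by
  rw [mem_stiefelTangent] at h
  rw [symPart, transpose_mul, transpose_transpose, h, smul_zero]

theorem sub_mul_symPart_mem {U : Matrix (Fin m) (Fin p) ℝ} (hU : Uᵀ * U = 1)
    (ξ : Matrix (Fin m) (Fin p) ℝ) : ξ - U * symPart (Uᵀ * ξ) ∈ stiefelTangent U := by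
  rw [mem_stiefelTangent, transpose_sub, transpose_mul, symPart_transpose, Matrix.mul_sub,
    Matrix.sub_mul, ← Matrix.mul_assoc, hU, Matrix.one_mul, Matrix.mul_assoc, hU, Matrix.mul_one,
    symPart, transpose_mul, transpose_transpose]
  have : (1 / 2 : ℝ) • (Uᵀ * ξ + ξᵀ * U) + (1 / 2 : ℝ) • (Uᵀ * ξ + ξᵀ * U) =
      Uᵀ * ξ + ξᵀ * U := by
    rw [← add_smul]; norm_num
  rw [sub_add_sub_comm, this, sub_self]

/-- The symmetric bilinear form with `cost A μ y = costForm A μ y y / 2`. -/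
noncomputable def costForm (A : Matrix (Fin m) (Fin n) ℝ) (μ : Fin p → ℝ) :
    Ambient m n p →ₗ[ℝ] Ambient m n p →ₗ[ℝ] ℝ :=
  (LinearMap.mk₂ ℝ (fun y θ : Ambient m n p =>
      -(frobInner θ.1 (A * y.2 * diagonal μ) + frobInner θ.2 (Aᵀ * y.1 * diagonal μ)))
    (fun y y' θ => by
      simp only [Prod.fst_add, Prod.snd_add, Matrix.mul_add, Matrix.add_mul, frobInner_add_right]
      ring)
    (fun c y θ => by
      simp only [Prod.smul_fst, Prod.smul_snd, Matrix.mul_smul, Matrix.smul_mul,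
        frobInner_smul_right, smul_eq_mul]
      ring)
    (fun y θ θ' => by
      simp only [Prod.fst_add, Prod.snd_add, frobInner_add_left]
      ring)
    (fun c y θ => by
      simp only [Prod.smul_fst, Prod.smul_snd, frobInner_smul_left, smul_eq_mul]
      ring))

theorem costForm_apply (A : Matrix (Fin m) (Fin n) ℝ) (μ : Fin p → ℝ) (y θ : Ambient m n p) :
    costForm A μ y θ =
      -(frobInner θ.1 (A * y.2 * diagonal μ) + frobInner θ.2 (Aᵀ * y.1 * diagonal μ)) := rfl

theorem frobInner_mul_diagonal_comm (A : Matrix (Fin m) (Fin n) ℝ) (μ : Fin p → ℝ)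
    (X : Matrix (Fin m) (Fin p) ℝ) (Y : Matrix (Fin n) (Fin p) ℝ) :
    frobInner Y (Aᵀ * X * diagonal μ) = frobInner X (A * Y * diagonal μ) := by
  rw [frobInner_comm, frobInner_mul_right, diagonal_transpose, frobInner_mul_left,
    transpose_transpose, Matrix.mul_assoc]

theorem costForm_comm (A : Matrix (Fin m) (Fin n) ℝ) (μ : Fin p → ℝ) (y θ : Ambient m n p) :
    costForm A μ y θ = costForm A μ θ y := by
  rw [costForm_apply, costForm_apply, frobInner_mul_diagonal_comm, frobInner_mul_diagonal_comm]
  ring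

theorem cost_eq_costForm (A : Matrix (Fin m) (Fin n) ℝ) (μ : Fin p → ℝ) (y : Ambient m n p) :
    cost A μ y = (1 / 2) * costForm A μ y y := by
  rw [costForm_apply, frobInner_mul_diagonal_comm, cost, frobInner]
  simp only [Matrix.mul_assoc]
  ring

/-- The normal component `(U sym(Vᵀ θ₁), …)` entering the tangential projection, as a bilinear
function of the base point. -/
noncomputable def normalForm (θ : Ambient m n p) :
    Ambient m n p →ₗ[ℝ] Ambient m n p →ₗ[ℝ] Ambient m n p :=
  (LinearMap.mk₂ ℝ (fun y z : Ambient m n p =>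
      ((y.1 * symPart (z.1ᵀ * θ.1), y.2 * symPart (z.2ᵀ * θ.2)) : Ambient m n p))
    (fun y y' z => by simp [Matrix.add_mul])
    (fun c y z => by simp)
    (fun y z z' => by simp [Matrix.add_mul, Matrix.mul_add, symPart_add])
    (fun c y z => by simp [symPart_smul]))

theorem normalForm_apply (θ y z : Ambient m n p) :
    normalForm θ y z = (y.1 * symPart (z.1ᵀ * θ.1), y.2 * symPart (z.2ᵀ * θ.2)) := rfl

/-- The orthogonal projection onto the tangent space of `St(p, m) × St(p, n)` at `y`. -/
noncomputable def tangentProj (y : Ambient m n p) : Ambient m n p →ₗ[ℝ] Ambient m n p :=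
  { toFun := fun θ => θ - normalForm θ y y
    map_add' := fun θ θ' => by
      simp only [normalForm_apply, Prod.fst_add, Prod.snd_add, Matrix.mul_add, symPart_add]
      ext <;> simp <;> ring
    map_smul' := fun c θ => by
      simp [normalForm_apply, symPart_smul, smul_sub] }

theorem tangentProj_apply (y θ : Ambient m n p) :
    tangentProj y θ = θ - normalForm θ y y := rfl

/-- The first slot is free because only the second one enters `symPart`. This is the hypothesis
`hRT` of `riemannianHessian_critical_of_quadratic`. -/
theorem normalForm_eq_zero {y θ : Ambient m n p} (hθ : θ ∈ tangent y) (z : Ambient m n p) :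
    normalForm θ z y = 0 := by
  rw [normalForm_apply, symPart_eq_zero_of_mem hθ.1, symPart_eq_zero_of_mem hθ.2]
  simp

theorem tangentProj_mem {y : Ambient m n p} (hy : y ∈ stiefelProd m n p) (θ : Ambient m n p) :
    tangentProj y θ ∈ tangent y :=
  ⟨sub_mul_symPart_mem hy.1 θ.1, sub_mul_symPart_mem hy.2 θ.2⟩

theorem exists_stiefelProd_curve {y η : Ambient m n p} (hy : y ∈ stiefelProd m n p)
    (hη : η ∈ tangent y) :
    ∃ c : ℝ → Ambient m n p, c 0 = y ∧ HasDerivAt c η 0 ∧ ∀ t, c t ∈ stiefelProd m n p := by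
  obtain ⟨c₁, h0, hd, hc⟩ := exists_stiefel_curve hy.1 hη.1
  obtain ⟨c₂, h0', hd', hc'⟩ := exists_stiefel_curve hy.2 hη.2
  exact ⟨fun t => (c₁ t, c₂ t), Prod.ext h0 h0', hd.prodMk hd', fun t => ⟨hc t, hc' t⟩⟩

/-- The metric `⟨ξ₁, η₁ S₁⟩ + ⟨ξ₂, η₂ S₂⟩`. -/
noncomputable def weightedForm (S : Matrix (Fin p) (Fin p) ℝ × Matrix (Fin p) (Fin p) ℝ) :
    Ambient m n p →ₗ[ℝ] Ambient m n p →ₗ[ℝ] ℝ :=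
  (LinearMap.mk₂ ℝ (fun ξ θ : Ambient m n p =>
      frobInner ξ.1 (θ.1 * S.1) + frobInner ξ.2 (θ.2 * S.2))
    (fun y y' θ => by
      simp only [Prod.fst_add, Prod.snd_add, frobInner_add_left]
      ring)
    (fun c y θ => by
      simp only [Prod.smul_fst, Prod.smul_snd, frobInner_smul_left, smul_eq_mul]
      ring)
    (fun y θ θ' => by
      simp only [Prod.fst_add, Prod.snd_add, Matrix.add_mul, frobInner_add_right]
      ring)
    (fun c y θ => by
      simp only [Prod.smul_fst, Prod.smul_snd, Matrix.smul_mul, frobInner_smul_right, smul_eq_mul]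
      ring))

theorem weightedForm_apply (S : Matrix (Fin p) (Fin p) ℝ × Matrix (Fin p) (Fin p) ℝ)
    (ξ θ : Ambient m n p) :
    weightedForm S ξ θ = frobInner ξ.1 (θ.1 * S.1) + frobInner ξ.2 (θ.2 * S.2) := rfl

theorem continuous_weightedForm (ξ θ : Ambient m n p) :
    Continuous fun S => weightedForm S ξ θ := by
  simp only [weightedForm_apply, frobInner]
  fun_prop

/-- The second-order form of the cost at a pair of leading singular vectors. -/
noncomputable def hessForm (A : Matrix (Fin m) (Fin n) ℝ) (μ : Fin p → ℝ) (η θ : Ambient m n p) :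
    ℝ :=
  frobInner (η.1 * diagonal (fun i : Fin p => sv A i * μ i)) θ.1 +
    frobInner (η.2 * diagonal (fun i : Fin p => sv A i * μ i)) θ.2 -
    frobInner (A * η.2 * diagonal μ) θ.1 - frobInner (Aᵀ * η.1 * diagonal μ) θ.2

/-- A diagonal matrix is symmetric, so pairing with it does not distinguish a matrix from its
symmetric part. This turns the curvature term of the Hessian into a diagonal weighting. -/
theorem frobInner_mul_symPart {a : ℕ} {U ξ θ : Matrix (Fin a) (Fin p) ℝ} (hU : Uᵀ * U = 1)
    (d : Fin p → ℝ) :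
    frobInner (U * symPart (ξᵀ * θ)) (U * diagonal d) = frobInner (ξ * diagonal d) θ := by
  have h : frobInner (ξᵀ * θ)ᵀ (diagonal d) = frobInner (ξᵀ * θ) (diagonal d) := by
    rw [← frobInner_transpose, transpose_transpose, diagonal_transpose]
  rw [frobInner_mul_left, ← Matrix.mul_assoc, hU, Matrix.one_mul, symPart, frobInner_smul_left,
    frobInner_add_left, h, frobInner_mul_left, transpose_transpose, frobInner_comm]
  ring

/-- The Riemannian Hessian of the cost at leading singular vectors, for a right-preconditioned
metric. -/
theorem riemannianHessian_cost {A : Matrix (Fin m) (Fin n) ℝ} {μ : Fin p → ℝ}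
    {x : Ambient m n p} (hx : IsLeadingSingularPair A x)
    {S : Ambient m n p → Matrix (Fin p) (Fin p) ℝ × Matrix (Fin p) (Fin p) ℝ}
    (hS : Continuous S) (hpos : ∀ y (ξ : Ambient m n p), ξ ≠ 0 → 0 < weightedForm (S y) ξ ξ) :
    (∃! H, IsRiemannianHessian (stiefelProd m n p) tangent (fun y ξ θ => weightedForm (S y) ξ θ)
      (cost A μ) x H) ∧
    ∀ η θ : tangent x, weightedForm (S x) (riemannianHessian (stiefelProd m n p) tangent
      (fun y ξ θ => weightedForm (S y) ξ θ) (cost A μ) x η) (θ : Ambient m n p) =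
        hessForm A μ η θ := by
  obtain ⟨hU, hV, hAV, hAU⟩ := hx
  have hxM : x ∈ stiefelProd m n p := ⟨hU, hV⟩
  have h1 : A * x.2 * diagonal μ = x.1 * diagonal (fun i : Fin p => sv A i * μ i) := by
    rw [hAV, Matrix.mul_assoc, diagonal_mul_diagonal]
  have h2 : Aᵀ * x.1 * diagonal μ = x.2 * diagonal (fun i : Fin p => sv A i * μ i) := by
    rw [hAU, Matrix.mul_assoc, diagonal_mul_diagonal]
  have hN : ∀ η θ : Ambient m n p, costForm A μ x (normalForm θ x η) =
      -(frobInner (η.1 * diagonal (fun i : Fin p => sv A i * μ i)) θ.1 +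
        frobInner (η.2 * diagonal (fun i : Fin p => sv A i * μ i)) θ.2) := by
    intro η θ
    rw [costForm_apply, normalForm_apply, h1, h2]
    simp only
    rw [frobInner_mul_symPart hU, frobInner_mul_symPart hV]
  -- Criticality: the gradient of the cost is `U` times a diagonal matrix, which is orthogonal to
  -- all tangent vectors, since `Uᵀ ξ` is skew.
  have hskew : ∀ {a : ℕ} {U ξ : Matrix (Fin a) (Fin p) ℝ} (d : Fin p → ℝ),
      ξ ∈ stiefelTangent U → frobInner ξ (U * diagonal d) = 0 := by
    intro a U ξ d hξ
    have h3 := symPart_eq_zero_of_mem hξ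
    have h4 : frobInner (Uᵀ * ξ)ᵀ (diagonal d) = frobInner (Uᵀ * ξ) (diagonal d) := by
      rw [← frobInner_transpose, transpose_transpose, diagonal_transpose]
    have h5 : frobInner (symPart (Uᵀ * ξ)) (diagonal d) = frobInner ξ (U * diagonal d) := by
      rw [symPart, frobInner_smul_left, frobInner_add_left, h4, frobInner_mul_left,
        transpose_transpose]
      ring
    rw [← h5, h3]
    simp [frobInner]
  have hcrit : ∀ θ ∈ tangent x, costForm A μ x θ = 0 := by
    intro θ hθ
    rw [costForm_apply, h1, h2, hskew _ hθ.1, hskew _ hθ.2]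
    simp
  have he : ∀ ξ : Ambient m n p, ξ ≠ 0 → 0 < weightedForm (1, 1) ξ ξ := by
    intro ξ hξ
    simp only [weightedForm_apply, Matrix.mul_one]
    by_cases h : ξ.1 = 0
    · have h' : ξ.2 ≠ 0 := fun h' => hξ (Prod.ext h h')
      exact add_pos_of_nonneg_of_pos (frobInner_self_nonneg _) (frobInner_self_pos h')
    · exact add_pos_of_pos_of_nonneg (frobInner_self_pos h) (frobInner_self_nonneg _)
  have key := riemannianHessian_critical_of_quadratic (M := stiefelProd m n p) (T := tangent)
    (g := fun y => weightedForm (S y)) (e := weightedForm (1, 1)) (D := costForm A μ)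
    (Q := tangentProj) (R := normalForm) (f := cost A μ) (x := x) hxM he (costForm_comm A μ)
    (cost_eq_costForm A μ) tangentProj_apply (fun y hy => tangentProj_mem hy)
    (fun y _ θ hθ z => normalForm_eq_zero hθ z) (fun y _ ξ _ => hpos y ξ)
    (fun ξ θ => ((continuous_weightedForm ξ θ).comp hS).continuousAt) hcrit
    (fun η => exists_stiefelProd_curve hxM)
  refine ⟨key.1, fun η θ => (key.2 η θ).trans ?_⟩
  rw [hN, costForm_apply, hessForm, frobInner_comm (θ : Ambient m n p).1,
    frobInner_comm (θ : Ambient m n p).2]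
  ring

end Stiefel

/-! ### Singular vectors: the orthogonal complement of the leading ones. -/

section Singular

variable {m n p : ℕ}

theorem sv_nonneg (A : Matrix (Fin m) (Fin n) ℝ) (i : ℕ) : 0 ≤ sv A i :=
  LinearMap.singularValues_nonneg _ i

theorem sv_antitone (A : Matrix (Fin m) (Fin n) ℝ) : Antitone (sv A) :=
  LinearMap.singularValues_antitone _

/-- An orthonormal basis of right singular vectors. -/
theorem exists_right_singular_basis (A : Matrix (Fin m) (Fin n) ℝ) :
    ∃ b : Fin n → Fin n → ℝ, (∀ i, b i ⬝ᵥ b i = 1) ∧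
      (∀ i, Aᵀ *ᵥ (A *ᵥ b i) = sv A i ^ 2 • b i) ∧
      (∀ k, k = ∑ i, (b i ⬝ᵥ k) • b i) := by
  set T := toEuclideanLin A with hT
  have hn : Module.finrank ℝ (EuclideanSpace ℝ (Fin n)) = n := by simp
  let e := T.isSymmetric_adjoint_comp_self.eigenvectorBasis hn
  refine ⟨fun i => WithLp.ofLp (e i), fun i => ?_, fun i => ?_, fun k => ?_⟩
  · have h := inner_self_eq_one_of_norm_eq_one (𝕜 := ℝ) (e.norm_eq_one i)
    rw [EuclideanSpace.inner_eq_star_dotProduct] at h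
    exact h
  · have h := T.isSymmetric_adjoint_comp_self.apply_eigenvectorBasis hn i
    rw [← T.sq_singularValues_fin hn i, LinearMap.comp_apply] at h
    have h1 : LinearMap.adjoint T (T (e i)) = toEuclideanLin Aᵀ (T (e i)) := by
      rw [hT, ← toEuclideanLin_conjTranspose_eq_adjoint, conjTranspose_eq_transpose_of_trivial]
    exact congrArg WithLp.ofLp (h1.symm.trans h)
  · have h := congrArg WithLp.ofLp (e.sum_repr' (WithLp.toLp 2 k))
    rw [WithLp.ofLp_sum] at h
    refine h.symm.trans (Finset.sum_congr rfl fun i _ => ?_)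
    simp [EuclideanSpace.inner_eq_star_dotProduct, dotProduct_comm]

/-- The index `i` may lie beyond `p`: the strict gap after the smaller of the two indices, together
with monotonicity, separates the values. Hence the leading eigenvalues of `AᵀA` are simple. -/
theorem sq_sv_ne {A : Matrix (Fin m) (Fin n) ℝ} (hσ : ∀ i < p, sv A (i + 1) < sv A i) {j i : ℕ}
    (hj : j < p) (hij : i ≠ j) : sv A i ^ 2 ≠ sv A j ^ 2 := by
  intro h
  have h' : sv A i = sv A j := by
    rwa [sq_eq_sq₀ (sv_nonneg A i) (sv_nonneg A j)] at h
  rcases lt_or_gt_of_ne hij with hlt | hgt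
  · have h1 := hσ i (hlt.trans hj)
    have h2 := sv_antitone A (Nat.succ_le_of_lt hlt)
    simp only [Nat.succ_eq_add_one] at h2
    linarith
  · have h1 := hσ j hj
    have h2 := sv_antitone A (Nat.succ_le_of_lt hgt)
    simp only [Nat.succ_eq_add_one] at h2
    linarith

theorem dotProduct_transpose_mulVec (A : Matrix (Fin m) (Fin n) ℝ) (u : Fin m → ℝ)
    (v : Fin n → ℝ) : (Aᵀ *ᵥ u) ⬝ᵥ v = u ⬝ᵥ (A *ᵥ v) := by
  rw [mulVec_transpose, dotProduct_mulVec]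

/-- The orthogonal complement of the leading right singular vectors: `A` is bounded there by the
next singular value, which is attained. -/
theorem complement_right_singular {A : Matrix (Fin m) (Fin n) ℝ}
    (hσ : ∀ i < p, sv A (i + 1) < sv A i) (hpn : p < n) {V : Matrix (Fin n) (Fin p) ℝ}
    (hV : Vᵀ * V = 1)
    (hAV : Aᵀ * (A * V) = V * diagonal (fun i : Fin p => sv A i ^ 2)) :
    (∀ k, Vᵀ *ᵥ k = 0 → (A *ᵥ k) ⬝ᵥ (A *ᵥ k) ≤ sv A p ^ 2 * (k ⬝ᵥ k)) ∧
    ∃ v, v ⬝ᵥ v = 1 ∧ Vᵀ *ᵥ v = 0 ∧ Aᵀ *ᵥ (A *ᵥ v) = sv A p ^ 2 • v := by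
  obtain ⟨b, hb1, hbA, hbk⟩ := exists_right_singular_basis A
  have hcol : ∀ j : Fin p, Aᵀ *ᵥ (A *ᵥ V.col j) = sv A j ^ 2 • V.col j := by
    intro j
    have h : Aᵀ *ᵥ (A *ᵥ V.col j) = (Aᵀ * (A * V)).col j := rfl
    rw [h, hAV]
    ext i
    simp [Matrix.col_apply, mul_comm]
  have hnorm : ∀ j : Fin p, V.col j ⬝ᵥ V.col j = 1 := by
    intro j
    have := congrFun (congrFun hV j) j
    simpa [mul_apply, dotProduct] using this
  -- Eigenvectors of the symmetric matrix `AᵀA` for different eigenvalues are orthogonal.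
  have horth : ∀ (i : Fin n) (j : Fin p), (i : ℕ) ≠ j → b i ⬝ᵥ V.col j = 0 := by
    intro i j hij
    have h1 : (Aᵀ *ᵥ (A *ᵥ b i)) ⬝ᵥ V.col j = b i ⬝ᵥ (Aᵀ *ᵥ (A *ᵥ V.col j)) := by
      rw [dotProduct_transpose_mulVec, dotProduct_comm (b i), dotProduct_transpose_mulVec,
        dotProduct_comm]
    rw [hbA, hcol, smul_dotProduct, dotProduct_smul, smul_eq_mul, smul_eq_mul] at h1
    have h2 := sq_sv_ne hσ j.2 hij
    have h3 : (sv A i ^ 2 - sv A j ^ 2) * (b i ⬝ᵥ V.col j) = 0 := by linarith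
    exact (mul_eq_zero.1 h3).resolve_left (sub_ne_zero.2 h2)
  have hmem : ∀ (k : Fin n → ℝ), Vᵀ *ᵥ k = 0 ↔ ∀ j, V.col j ⬝ᵥ k = 0 := by
    intro k
    exact funext_iff
  constructor
  · intro k hk
    rw [hmem] at hk
    -- By simplicity the `i`-th column of `V` is a nonzero multiple of `b i`, so orthogonality to
    -- `V` removes the first `p` coefficients of `k`.
    have hzero : ∀ i : Fin n, (i : ℕ) < p → b i ⬝ᵥ k = 0 := by
      intro i hi
      have h1 : V.col ⟨i, hi⟩ = (b i ⬝ᵥ V.col ⟨i, hi⟩) • b i := by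
        conv_lhs => rw [hbk (V.col ⟨i, hi⟩)]
        refine Finset.sum_eq_single i (fun l _ hl => ?_) (by simp)
        rw [horth l ⟨i, hi⟩ (fun h => hl (Fin.ext h)), zero_smul]
      have h2 := hk ⟨i, hi⟩
      rw [h1, smul_dotProduct, smul_eq_mul] at h2
      refine (mul_eq_zero.1 h2).resolve_left fun h => ?_
      have h3 := hnorm ⟨i, hi⟩
      rw [h1, h] at h3
      simp at h3
    have h1 : k ⬝ᵥ k = ∑ i, (b i ⬝ᵥ k) ^ 2 := by
      conv_lhs => enter [1]; rw [hbk k]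
      rw [sum_dotProduct]
      exact Finset.sum_congr rfl fun i _ => by rw [smul_dotProduct, smul_eq_mul, sq]
    have h2 : (A *ᵥ k) ⬝ᵥ (A *ᵥ k) = ∑ i : Fin n, sv A i ^ 2 * (b i ⬝ᵥ k) ^ 2 := by
      conv_lhs => enter [1, 2]; rw [hbk k]
      rw [dotProduct_comm, ← dotProduct_transpose_mulVec, dotProduct_comm, sum_dotProduct]
      refine Finset.sum_congr rfl fun i _ => ?_
      have h3 : b i ⬝ᵥ (Aᵀ *ᵥ (A *ᵥ k)) = sv A i ^ 2 * (b i ⬝ᵥ k) := by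
        rw [dotProduct_comm, dotProduct_transpose_mulVec, dotProduct_comm,
          ← dotProduct_transpose_mulVec, hbA, smul_dotProduct, smul_eq_mul]
      rw [smul_dotProduct, smul_eq_mul, h3]
      ring
    rw [h1, h2, Finset.mul_sum]
    refine Finset.sum_le_sum fun i _ => ?_
    by_cases hi : (i : ℕ) < p
    · simp [hzero i hi]
    · have := sv_antitone A (not_lt.1 hi)
      have := sv_nonneg A i
      gcongr
  -- Indices start at zero, so index `p` is the first one not used by `V`.
  · refine ⟨b ⟨p, hpn⟩, hb1 _, ?_, hbA _⟩
    rw [hmem]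
    intro j
    rw [dotProduct_comm]
    exact horth _ _ j.2.ne'

theorem exists_orthogonal_vector (hpm : p < m) (U : Matrix (Fin m) (Fin p) ℝ) :
    ∃ u, u ≠ 0 ∧ Uᵀ *ᵥ u = 0 := by
  have h : ¬ Function.Injective (Uᵀ).mulVecLin := by
    intro h
    have := LinearMap.finrank_le_finrank_of_injective h
    simp at this
    omega
  rw [← LinearMap.ker_eq_bot, ← ne_eq, Submodule.ne_bot_iff] at h
  obtain ⟨u, hu, hne⟩ := h
  exact ⟨u, hne, hu⟩

/-- The next singular pair after the leading ones. -/
theorem exists_next_singular_pair {A : Matrix (Fin m) (Fin n) ℝ}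
    (hσ : ∀ i < p, sv A (i + 1) < sv A i) (hpmn : p < min m n) {x : Ambient m n p}
    (hx : IsLeadingSingularPair A x) :
    (∀ k₁ k₂, x.2ᵀ *ᵥ k₂ = 0 →
      |2 * (k₁ ⬝ᵥ (A *ᵥ k₂))| ≤ sv A p * (k₁ ⬝ᵥ k₁ + k₂ ⬝ᵥ k₂)) ∧
    ∃ u v, u ≠ 0 ∧ x.1ᵀ *ᵥ u = 0 ∧ x.2ᵀ *ᵥ v = 0 ∧
      A *ᵥ v = sv A p • u ∧ Aᵀ *ᵥ u = sv A p • v := by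
  obtain ⟨hU, hV, hAV, hAU⟩ := hx
  have hAAV : Aᵀ * (A * x.2) = x.2 * diagonal (fun i : Fin p => sv A i ^ 2) := by
    rw [hAV, ← Matrix.mul_assoc, hAU, Matrix.mul_assoc, diagonal_mul_diagonal]
    simp only [sq]
  obtain ⟨hle, v, hv1, hVv, hAv⟩ :=
    complement_right_singular hσ (hpmn.trans_le (min_le_right _ _)) hV hAAV
  set s := sv A p with hs
  have hs0 : 0 ≤ s := sv_nonneg A p
  have hself : ∀ {a : ℕ} (w : Fin a → ℝ), 0 ≤ w ⬝ᵥ w := fun w =>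
    Finset.sum_nonneg fun i _ => mul_self_nonneg _
  constructor
  · intro k₁ k₂ hk
    have h1 := hle k₂ hk
    rcases hs0.eq_or_lt with h0 | hpos
    · rw [← h0] at h1 ⊢
      have h2 : A *ᵥ k₂ = 0 := by
        rw [← dotProduct_self_eq_zero]
        refine le_antisymm (by simpa using h1) (hself _)
      simp [h2]
    -- Expanding `‖s k₁ ∓ A k₂‖² ≥ 0` with `‖A k₂‖² ≤ s²‖k₂‖²` gives the claim multiplied by `s`;
    -- this is why `s = 0` is a separate case.
    · have h2 := hself (s • k₁ - A *ᵥ k₂)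
      have h3 := hself (s • k₁ + A *ᵥ k₂)
      simp only [sub_dotProduct, dotProduct_sub, add_dotProduct, dotProduct_add, smul_dotProduct,
        dotProduct_smul, smul_eq_mul, dotProduct_comm (A *ᵥ k₂) k₁] at h2 h3
      rw [abs_le]
      constructor
      · refine le_of_mul_le_mul_left ?_ hpos
        linarith
      · refine le_of_mul_le_mul_left ?_ hpos
        linarith
  · have hVA : ∀ w : Fin m → ℝ, x.1ᵀ *ᵥ w = 0 → x.2ᵀ *ᵥ (Aᵀ *ᵥ w) = 0 := by
      intro w hw
      rw [mulVec_mulVec, ← transpose_mul, hAV, transpose_mul, ← mulVec_mulVec, hw, mulVec_zero]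
    rcases hs0.eq_or_lt with h0 | hpos
    -- For `s = 0` the vector `s⁻¹ A v` is useless, but any nonzero `u` orthogonal to `U` works: `Aᵀ
    -- u` is orthogonal to `V`, hence killed by `A`, so `‖Aᵀ u‖² = u ⬝ A Aᵀ u = 0`.
    · obtain ⟨u, hu, hUu⟩ := exists_orthogonal_vector (hpmn.trans_le (min_le_left _ _)) x.1
      have hA0 : ∀ k, x.2ᵀ *ᵥ k = 0 → A *ᵥ k = 0 := by
        intro k hk
        have h1 := hle k hk
        rw [← dotProduct_self_eq_zero]
        refine le_antisymm ?_ (hself _)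
        simpa [← h0] using h1
      refine ⟨u, v, hu, hUu, hVv, ?_, ?_⟩
      · rw [← h0, zero_smul, hA0 v hVv]
      · rw [← h0, zero_smul, ← dotProduct_self_eq_zero, dotProduct_transpose_mulVec,
          hA0 _ (hVA u hUu), dotProduct_zero]
    · refine ⟨s⁻¹ • (A *ᵥ v), v, ?_, ?_, hVv, ?_, ?_⟩
      · intro h
        rw [smul_eq_zero] at h
        have h1 : A *ᵥ v = 0 := h.resolve_left (inv_ne_zero hpos.ne')
        rw [h1, mulVec_zero] at hAv
        have h2 : v = 0 := (smul_eq_zero.1 hAv.symm).resolve_left (pow_ne_zero 2 hpos.ne')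
        rw [h2] at hv1
        simp at hv1
      · have h1 : x.1ᵀ * A = diagonal (fun i : Fin p => sv A i) * x.2ᵀ := by
          have := congrArg transpose hAU
          simpa [transpose_mul] using this
        rw [mulVec_smul, mulVec_mulVec, h1, ← mulVec_mulVec, hVv, mulVec_zero, smul_zero]
      · rw [smul_smul, mul_inv_cancel₀ hpos.ne', one_smul]
      · rw [mulVec_smul, hAv, smul_smul, sq, ← mul_assoc, inv_mul_cancel₀ hpos.ne', one_mul]

end Singular

/-! ### Rayleigh bounds and explicit eigenvectors of the Hessian. -/

section Spectrum

variable {m n p : ℕ}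

theorem frobInner_mul_diagonal {a : ℕ} (X Y : Matrix (Fin a) (Fin p) ℝ) (d : Fin p → ℝ) :
    frobInner (X * diagonal d) Y = ∑ j, d j * (X.col j ⬝ᵥ Y.col j) := by
  simp only [frobInner_eq_sum, dotProduct, Finset.mul_sum, mul_diagonal, col_apply]
  exact Finset.sum_congr rfl fun j _ => Finset.sum_congr rfl fun i _ => by ring

theorem weightedForm_diagonal_apply (d : Fin p → ℝ) (ξ θ : Ambient m n p) :
    weightedForm (diagonal d, diagonal d) ξ θ =
      frobInner (ξ.1 * diagonal d) θ.1 + frobInner (ξ.2 * diagonal d) θ.2 := by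
  rw [weightedForm_apply, frobInner_comm ξ.1, frobInner_comm ξ.2]
  simp only [frobInner_mul_diagonal, dotProduct_comm]

/-- Splitting a matrix into its components in the range of `U` and orthogonal to it. -/
theorem frobInner_mul_diagonal_split {a : ℕ} {U : Matrix (Fin a) (Fin p) ℝ} (hU : Uᵀ * U = 1)
    (d : Fin p → ℝ) {Ω : Matrix (Fin p) (Fin p) ℝ} {K : Matrix (Fin a) (Fin p) ℝ}
    (hK : Uᵀ * K = 0) :
    frobInner ((U * Ω + K) * diagonal d) (U * Ω + K) =
      frobInner (Ω * diagonal d) Ω + frobInner (K * diagonal d) K := by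
  have h0 : ∀ X : Matrix (Fin p) (Fin p) ℝ, frobInner X 0 = 0 := fun X => by simp [frobInner]
  rw [Matrix.add_mul, frobInner_add_left, frobInner_add_right, frobInner_add_right,
    Matrix.mul_assoc U, frobInner_mul_left U _ (U * Ω), frobInner_mul_left U _ K, hK, h0,
    frobInner_comm _ (U * Ω), frobInner_mul_left U Ω, ← Matrix.mul_assoc Uᵀ U, hU, Matrix.one_mul,
    ← Matrix.mul_assoc Uᵀ K, hK, Matrix.zero_mul, h0]
  ring

/-- A quadratic form in two skew-symmetric matrices is nonnegative if it is so for each pair of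
opposite entries. -/
theorem skew_sum_nonneg {a b : Matrix (Fin p) (Fin p) ℝ} (ha : ∀ i j, a i j = -a j i)
    (hb : ∀ i j, b i j = -b j i) {α : Fin p → ℝ} {β : Fin p → Fin p → ℝ}
    (h : ∀ i j, i ≠ j → |β i j + β j i| ≤ α i + α j) :
    0 ≤ ∑ j, ∑ i, (α j * (a i j ^ 2 + b i j ^ 2) + 2 * β i j * (a i j * b i j)) := by
  set F : Fin p → Fin p → ℝ := fun j i =>
    α j * (a i j ^ 2 + b i j ^ 2) + 2 * β i j * (a i j * b i j) with hF
  -- Averaging over transposed entries makes only the sums `α i + α j` and `β i j + β j i` appear.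
  have h1 : ∑ j, ∑ i, F j i = ∑ j, ∑ i, (F j i + F i j) / 2 := by
    have h2 : ∑ j, ∑ i, F i j = ∑ j, ∑ i, F j i := Finset.sum_comm
    simp only [← Finset.sum_div, Finset.sum_add_distrib, h2]
    ring
  rw [h1]
  refine Finset.sum_nonneg fun j _ => Finset.sum_nonneg fun i _ => ?_
  by_cases hij : i = j
  · subst hij
    have h2 : a i i = 0 := by linarith [ha i i]
    have h3 : b i i = 0 := by linarith [hb i i]
    simp [hF, h2, h3]
  · have h2 := abs_le.1 (h i j hij)
    simp only [hF]
    rw [ha j i, hb j i]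
    -- The 2×2 form is diagonal in `a - b` and `a + b`.
    have h3 : 0 ≤ (α i + α j - (β i j + β j i)) * (a i j - b i j) ^ 2 :=
      mul_nonneg (by linarith) (sq_nonneg _)
    have h4 : 0 ≤ (α i + α j + (β i j + β j i)) * (a i j + b i j) ^ 2 :=
      mul_nonneg (by linarith) (sq_nonneg _)
    nlinarith

theorem skew_entries {a : ℕ} {U ξ : Matrix (Fin a) (Fin p) ℝ} (hξ : ξ ∈ stiefelTangent U)
    (i j : Fin p) : (Uᵀ * ξ) i j = -(Uᵀ * ξ) j i := by
  have h := congrFun (congrFun (mem_stiefelTangent.1 hξ) i) j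
  have h' : (ξᵀ * U) i j = (Uᵀ * ξ) j i := by
    rw [← transpose_apply (Uᵀ * ξ), transpose_mul, transpose_transpose]
  rw [Matrix.add_apply, h', Matrix.zero_apply] at h
  linarith

/-- Positivity of a combination of the metric and the second-order form of the cost. -/
theorem weightedForm_add_hessForm_nonneg {A : Matrix (Fin m) (Fin n) ℝ}
    (hσ : ∀ i < p, sv A (i + 1) < sv A i) (hpmn : p < min m n) {μ : Fin p → ℝ}
    {x : Ambient m n p} (hx : IsLeadingSingularPair A x) {d : Fin p → ℝ} {r ε : ℝ}
    (h1 : ∀ i j : Fin p, i ≠ j → |ε * (sv A i * μ j + sv A j * μ i)| ≤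
      r * (d i + d j) + ε * (sv A i * μ i + sv A j * μ j))
    (h2 : ∀ i : Fin p, |ε * μ i| * sv A p ≤ r * d i + ε * (sv A i * μ i))
    {η : Ambient m n p} (hη : η ∈ tangent x) :
    0 ≤ r * weightedForm (diagonal d, diagonal d) η η + ε * hessForm A μ η η := by
  have hnext := (exists_next_singular_pair hσ hpmn hx).1
  obtain ⟨hU, hV, hAV, hAU⟩ := hx
  -- `A` and `Aᵀ` exchange the spans of `V` and `U`, and also their orthogonal complements, so the
  -- form has no mixed terms between `Ω` and `K`.
  obtain ⟨Ω₁, hΩ₁⟩ : ∃ Ω, Ω = x.1ᵀ * η.1 := ⟨_, rfl⟩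
  obtain ⟨Ω₂, hΩ₂⟩ : ∃ Ω, Ω = x.2ᵀ * η.2 := ⟨_, rfl⟩
  obtain ⟨K₁, hη₁⟩ : ∃ K₁, η.1 = x.1 * Ω₁ + K₁ := ⟨η.1 - x.1 * Ω₁, by simp⟩
  obtain ⟨K₂, hη₂⟩ : ∃ K₂, η.2 = x.2 * Ω₂ + K₂ := ⟨η.2 - x.2 * Ω₂, by simp⟩
  have hs₁ : ∀ i j, Ω₁ i j = -Ω₁ j i := hΩ₁ ▸ skew_entries hη.1
  have hs₂ : ∀ i j, Ω₂ i j = -Ω₂ j i := hΩ₂ ▸ skew_entries hη.2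
  have hK₁ : x.1ᵀ * K₁ = 0 := by
    rw [hη₁, Matrix.mul_add, ← Matrix.mul_assoc, hU, Matrix.one_mul] at hΩ₁
    exact left_eq_add.1 hΩ₁
  have hK₂ : x.2ᵀ * K₂ = 0 := by
    rw [hη₂, Matrix.mul_add, ← Matrix.mul_assoc, hV, Matrix.one_mul] at hΩ₂
    exact left_eq_add.1 hΩ₂
  have hUA : x.1ᵀ * A = diagonal (fun i : Fin p => sv A i) * x.2ᵀ := by
    have := congrArg transpose hAU
    simpa [transpose_mul] using this
  have h0 : ∀ {a : ℕ} (X : Matrix (Fin a) (Fin p) ℝ), frobInner X 0 = 0 ∧ frobInner 0 X = 0 :=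
    fun X => by simp [frobInner]
  have hcross : frobInner (A * η.2 * diagonal μ) η.1 =
      frobInner (diagonal (fun i : Fin p => sv A i) * Ω₂ * diagonal μ) Ω₁ +
        frobInner (A * K₂ * diagonal μ) K₁ := by
    have e1 : A * η.2 * diagonal μ =
        x.1 * (diagonal (fun i : Fin p => sv A i) * Ω₂ * diagonal μ) + A * K₂ * diagonal μ := by
      rw [hη₂, Matrix.mul_add, Matrix.add_mul, ← Matrix.mul_assoc A, hAV]
      simp only [Matrix.mul_assoc]
    have e2 : x.1ᵀ * (A * K₂ * diagonal μ) = 0 := by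
      rw [← Matrix.mul_assoc, ← Matrix.mul_assoc, hUA, Matrix.mul_assoc _ _ K₂, hK₂,
        Matrix.mul_zero, Matrix.zero_mul]
    rw [e1, hη₁, frobInner_add_left, frobInner_mul_left, frobInner_add_right,
      frobInner_comm (A * K₂ * diagonal μ) (x.1 * Ω₁), frobInner_mul_left x.1 Ω₁, e2, (h0 _).1,
      Matrix.mul_add, ← Matrix.mul_assoc x.1ᵀ x.1, hU, Matrix.one_mul, hK₁, add_zero, zero_add]
  have hcross' : frobInner (Aᵀ * η.1 * diagonal μ) η.2 = frobInner (A * η.2 * diagonal μ) η.1 := by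
    rw [frobInner_comm, frobInner_mul_diagonal_comm, frobInner_comm]
  have hsplit₁ : ∀ d : Fin p → ℝ, frobInner (η.1 * diagonal d) η.1 =
      frobInner (Ω₁ * diagonal d) Ω₁ + frobInner (K₁ * diagonal d) K₁ := by
    intro d
    rw [hη₁]
    exact frobInner_mul_diagonal_split hU d hK₁
  have hsplit₂ : ∀ d : Fin p → ℝ, frobInner (η.2 * diagonal d) η.2 =
      frobInner (Ω₂ * diagonal d) Ω₂ + frobInner (K₂ * diagonal d) K₂ := by
    intro d
    rw [hη₂]
    exact frobInner_mul_diagonal_split hV d hK₂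
  have hΩ := skew_sum_nonneg hs₁ hs₂
    (α := fun j => r * d j + ε * (sv A j * μ j)) (β := fun i j => -(ε * (sv A i * μ j)))
    (fun i j hij => by
      have := h1 i j hij
      rw [← neg_add, abs_neg, ← mul_add]
      linarith)
  have hK : 0 ≤ ∑ j, ((r * d j + ε * (sv A j * μ j)) * (K₁.col j ⬝ᵥ K₁.col j + K₂.col j ⬝ᵥ K₂.col j)
      - 2 * (ε * μ j) * (K₁.col j ⬝ᵥ (A *ᵥ K₂.col j))) := by
    refine Finset.sum_nonneg fun j _ => ?_
    have e1 : x.2ᵀ *ᵥ K₂.col j = 0 := by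
      have : x.2ᵀ *ᵥ K₂.col j = (x.2ᵀ * K₂).col j := rfl
      rw [this, hK₂]
      rfl
    have e2 := hnext (K₁.col j) (K₂.col j) e1
    have e3 : 0 ≤ K₁.col j ⬝ᵥ K₁.col j + K₂.col j ⬝ᵥ K₂.col j :=
      add_nonneg (Finset.sum_nonneg fun i _ => mul_self_nonneg _)
        (Finset.sum_nonneg fun i _ => mul_self_nonneg _)
    have e4 : (ε * μ j) * (2 * (K₁.col j ⬝ᵥ (A *ᵥ K₂.col j))) ≤
        (|ε * μ j| * sv A p) * (K₁.col j ⬝ᵥ K₁.col j + K₂.col j ⬝ᵥ K₂.col j) := by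
      refine (le_abs_self _).trans ?_
      rw [abs_mul, mul_assoc]
      exact mul_le_mul_of_nonneg_left e2 (abs_nonneg _)
    have e5 := mul_le_mul_of_nonneg_right (h2 j) e3
    linarith
  have hcol : frobInner (A * K₂ * diagonal μ) K₁ =
      ∑ j, μ j * (K₁.col j ⬝ᵥ (A *ᵥ K₂.col j)) := by
    rw [frobInner_mul_diagonal]
    exact Finset.sum_congr rfl fun j _ => by rw [dotProduct_comm]; rfl
  have hmid : frobInner (diagonal (fun i : Fin p => sv A i) * Ω₂ * diagonal μ) Ω₁ =
      ∑ j, μ j * ∑ i : Fin p, sv A i * (Ω₁ i j * Ω₂ i j) := by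
    simp only [frobInner_eq_sum, mul_diagonal, diagonal_mul, Finset.mul_sum]
    exact Finset.sum_congr rfl fun j _ => Finset.sum_congr rfl fun i _ => by ring
  have hin : ∀ j, ∑ i : Fin p, ((r * d j + ε * (sv A j * μ j)) * (Ω₁ i j ^ 2 + Ω₂ i j ^ 2) +
      2 * -(ε * (sv A i * μ j)) * (Ω₁ i j * Ω₂ i j)) =
      (r * d j + ε * (sv A j * μ j)) * (Ω₁.col j ⬝ᵥ Ω₁.col j + Ω₂.col j ⬝ᵥ Ω₂.col j) -
        2 * (ε * μ j) * ∑ i : Fin p, sv A i * (Ω₁ i j * Ω₂ i j) := by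
    intro j
    simp only [dotProduct, ← Finset.sum_add_distrib, Finset.mul_sum, ← Finset.sum_sub_distrib,
      col_apply]
    exact Finset.sum_congr rfl fun i _ => by ring
  -- With the dot products replaced by arbitrary sequences, the regrouping is a termwise ring
  -- identity.
  have hsum : ∀ a₁ a₂ b k₁ k₂ q : Fin p → ℝ,
      r * (∑ j, d j * a₁ j + ∑ j, d j * k₁ j + (∑ j, d j * a₂ j + ∑ j, d j * k₂ j)) +
        ε * (∑ j : Fin p, sv A j * μ j * a₁ j + ∑ j : Fin p, sv A j * μ j * k₁ j +
          (∑ j : Fin p, sv A j * μ j * a₂ j + ∑ j : Fin p, sv A j * μ j * k₂ j) -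
          (∑ j, μ j * b j + ∑ j, μ j * q j) - (∑ j, μ j * b j + ∑ j, μ j * q j)) =
      ∑ j, ((r * d j + ε * (sv A j * μ j)) * (a₁ j + a₂ j) - 2 * (ε * μ j) * b j) +
        ∑ j, ((r * d j + ε * (sv A j * μ j)) * (k₁ j + k₂ j) - 2 * (ε * μ j) * q j) := by
    intro a₁ a₂ b k₁ k₂ q
    simp only [Finset.mul_sum, ← Finset.sum_add_distrib, ← Finset.sum_sub_distrib]
    exact Finset.sum_congr rfl fun j _ => by ring
  have hfin : r * weightedForm (diagonal d, diagonal d) η η + ε * hessForm A μ η η =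
      (∑ j, ∑ i : Fin p, ((r * d j + ε * (sv A j * μ j)) * (Ω₁ i j ^ 2 + Ω₂ i j ^ 2) +
        2 * -(ε * (sv A i * μ j)) * (Ω₁ i j * Ω₂ i j))) +
      ∑ j, ((r * d j + ε * (sv A j * μ j)) * (K₁.col j ⬝ᵥ K₁.col j + K₂.col j ⬝ᵥ K₂.col j)
        - 2 * (ε * μ j) * (K₁.col j ⬝ᵥ (A *ᵥ K₂.col j))) := by
    rw [weightedForm_diagonal_apply, hessForm, hcross', hcross, hsplit₁, hsplit₁, hsplit₂, hsplit₂,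
      hcol, hmid]
    simp only [frobInner_mul_diagonal, hin]
    exact hsum _ _ _ _ _ _
  rw [hfin]
  exact add_nonneg hΩ hK

/-- `c` is an eigenvalue if a tangent vector satisfies the eigenvalue equation weakly. -/
theorem hasEigenvalue_of_form {E : Type*} [AddCommGroup E] [Module ℝ E] {S : Submodule ℝ E}
    {w : E →ₗ[ℝ] E →ₗ[ℝ] ℝ} {h : E → E → ℝ} (hw : ∀ ξ, ξ ≠ 0 → 0 < w ξ ξ) {H : Module.End ℝ S}
    (hH : ∀ η θ : S, w (H η) θ = h η θ) {c : ℝ} {η : E} (hη : η ∈ S) (hne : η ≠ 0)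
    (hc : ∀ θ ∈ S, h η θ = c * w η θ) : H.HasEigenvalue c := by
  refine Module.End.hasEigenvalue_of_hasEigenvector (x := ⟨η, hη⟩) ?_
  rw [Module.End.hasEigenvector_iff, Module.End.mem_eigenspace_iff]
  refine ⟨?_, fun h => hne (congrArg Subtype.val h)⟩
  by_contra hcon
  set δ : S := H ⟨η, hη⟩ - c • ⟨η, hη⟩ with hδ
  have h1 : (δ : E) ≠ 0 := fun h0 => hcon (sub_eq_zero.1 (Subtype.ext h0))
  have h2 := hw _ h1
  have h3 : w (δ : E) (δ : E) = w (H ⟨η, hη⟩ : S) δ - c * w η δ := by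
    have : w (δ : E) = w (H ⟨η, hη⟩ : S) - c • w η := by
      rw [hδ, Submodule.coe_sub, map_sub, Submodule.coe_smul, map_smul]
    rw [this]
    simp
  rw [h3, hH, hc _ δ.2, sub_self] at h2
  exact lt_irrefl _ h2

/-- Tests the generator of the rotation in the plane `(i, j)` against a skew matrix. The entrywise
weight `q` covers the metric and both terms of the second-order form at once. -/
theorem frobInner_pair_mul_eq {Φ Ω : Matrix (Fin p) (Fin p) ℝ} (hΦ : ∀ i j, Φ i j = -Φ j i)
    {i j : Fin p} (hij : i ≠ j) (hΩ : Ω = single i j 1 - single j i 1) (q : Fin p → Fin p → ℝ) :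
    frobInner (of fun k l => Ω k l * q k l) Φ = (q i j + q j i) * Φ i j := by
  have h : (of fun k l => Ω k l * q k l) = single i j (q i j) - single j i (q j i) := by
    ext k l
    rw [hΩ]
    by_cases h1 : i = k ∧ j = l
    · obtain ⟨rfl, rfl⟩ := h1
      simp [single_apply, hij, hij.symm]
    · by_cases h2 : j = k ∧ i = l
      · obtain ⟨rfl, rfl⟩ := h2
        simp [single_apply, hij, hij.symm]
      · simp [single_apply, h1, h2]
  have h3 : ∀ (i j : Fin p) (c : ℝ), frobInner (single i j c) Φ = c * Φ i j := by
    intro i j c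
    rw [frobInner_eq_sum, Finset.sum_eq_single j, Finset.sum_eq_single i]
    · simp
    · intro b _ hb; simp [hb.symm]
    · simp
    · intro b _ hb; simp [hb.symm]
    · simp
  rw [h, frobInner_sub_left, h3, h3, hΦ j i]
  ring

theorem mul_mem_stiefelTangent {a : ℕ} {U : Matrix (Fin a) (Fin p) ℝ} (hU : Uᵀ * U = 1)
    {Ω : Matrix (Fin p) (Fin p) ℝ} (hΩ : Ωᵀ = -Ω) : U * Ω ∈ stiefelTangent U := by
  rw [mem_stiefelTangent, ← Matrix.mul_assoc, hU, Matrix.one_mul, transpose_mul, hΩ,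
    Matrix.mul_assoc, hU, Matrix.mul_one, add_neg_cancel]

section Eigenvalues

variable {A : Matrix (Fin m) (Fin n) ℝ} {μ : Fin p → ℝ} {x : Ambient m n p} {d : Fin p → ℝ}
  {H : Module.End ℝ (tangent x)}

/-- Eigenvalues of the Hessian for rotations inside the span of the leading singular vectors. -/
theorem hasEigenvalue_rotation (hx : IsLeadingSingularPair A x)
    (hd : ∀ ξ : Ambient m n p, ξ ≠ 0 → 0 < weightedForm (diagonal d, diagonal d) ξ ξ)
    (hd' : ∀ i, 0 < d i)
    (hH : ∀ η θ : tangent x, weightedForm (diagonal d, diagonal d) (H η : Ambient m n p)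
      (θ : Ambient m n p) = hessForm A μ η θ) {i j : Fin p} (hij : i ≠ j) {ε : ℝ}
    (hε : ε * ε = 1) :
    H.HasEigenvalue ((sv A i + ε * sv A j) * (μ i + ε * μ j) / (d i + d j)) := by
  obtain ⟨hU, hV, hAV, hAU⟩ := hx
  obtain ⟨Ω, hΩ⟩ : ∃ Ω : Matrix (Fin p) (Fin p) ℝ, Ω = single i j 1 - single j i 1 := ⟨_, rfl⟩
  have hΩt : Ωᵀ = -Ω := by rw [hΩ]; simp [transpose_single]
  have hΩt' : ((-ε) • Ω)ᵀ = -((-ε) • Ω) := by rw [transpose_smul, hΩt, smul_neg]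
  have hΩij : Ω i j = 1 := by rw [hΩ]; simp [hij]
  -- Opposite rotations of `U` and `V` (`ε = 1`) give the sums, equal rotations (`ε = -1`) the
  -- differences.
  refine hasEigenvalue_of_form hd hH (η := (x.1 * Ω, x.2 * ((-ε) • Ω)))
    ⟨mul_mem_stiefelTangent hU hΩt, mul_mem_stiefelTangent hV hΩt'⟩ ?_ ?_
  · intro h
    have h1 : x.1 * Ω = 0 := congrArg Prod.fst h
    have h2 : Ω = 0 := by
      rw [← Matrix.one_mul Ω, ← hU, Matrix.mul_assoc, h1, Matrix.mul_zero]
    rw [h2] at hΩij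
    simp at hΩij
  · intro θ hθ
    have hwt : ∀ {a : ℕ} {W ξ : Matrix (Fin a) (Fin p) ℝ}, ξ ∈ stiefelTangent W →
        frobInner (W * Ω * diagonal d) ξ = (d i + d j) * (Wᵀ * ξ) i j := by
      intro a W ξ hξ
      rw [Matrix.mul_assoc, frobInner_mul_left,
        ← (by ext; simp : (of fun k l => Ω k l * d l) = Ω * diagonal d),
        frobInner_pair_mul_eq (skew_entries hξ) hij hΩ fun _ l => d l]
      ring
    have hhs : ∀ {a : ℕ} {W ξ : Matrix (Fin a) (Fin p) ℝ}, ξ ∈ stiefelTangent W →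
        frobInner (W * Ω * diagonal (fun i : Fin p => sv A i * μ i)) ξ +
          ε * frobInner (W * (diagonal (fun i : Fin p => sv A i) * Ω * diagonal μ)) ξ =
          (sv A i + ε * sv A j) * (μ i + ε * μ j) * (Wᵀ * ξ) i j := by
      intro a W ξ hξ
      rw [Matrix.mul_assoc W, frobInner_mul_left W (Ω * _), frobInner_mul_left W,
        ← (by ext; simp : (of fun k l => Ω k l * (sv A l * μ l)) =
          Ω * diagonal (fun i : Fin p => sv A i * μ i)),
        ← (by ext; simp; ring : (of fun k l => Ω k l * (sv A k * μ l)) =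
          diagonal (fun i : Fin p => sv A i) * Ω * diagonal μ),
        frobInner_pair_mul_eq (skew_entries hξ) hij hΩ fun _ l => sv A l * μ l,
        frobInner_pair_mul_eq (skew_entries hξ) hij hΩ fun k l => sv A k * μ l]
      linear_combination -(sv A j * μ j * (Wᵀ * ξ) i j) * hε
    have e1 : A * (x.2 * ((-ε) • Ω)) * diagonal μ =
        (-ε) • (x.1 * (diagonal (fun i : Fin p => sv A i) * Ω * diagonal μ)) := by
      rw [← Matrix.mul_assoc, hAV]
      simp only [Matrix.mul_assoc, Matrix.mul_smul, Matrix.smul_mul]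
    have e2 : Aᵀ * (x.1 * Ω) * diagonal μ =
        x.2 * (diagonal (fun i : Fin p => sv A i) * Ω * diagonal μ) := by
      rw [← Matrix.mul_assoc, hAU]
      simp only [Matrix.mul_assoc]
    have e3 : ∀ e : Fin p → ℝ, x.2 * ((-ε) • Ω) * diagonal e = (-ε) • (x.2 * Ω * diagonal e) := by
      intro e
      rw [Matrix.mul_smul, Matrix.smul_mul]
    rw [weightedForm_diagonal_apply, hessForm]
    simp only
    rw [e1, e2, e3, e3, frobInner_smul_left, frobInner_smul_left, frobInner_smul_left, hwt hθ.1,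
      hwt hθ.2]
    have h1 := hhs hθ.1
    have h2 := hhs hθ.2
    have hdp : d i + d j ≠ 0 := (add_pos (hd' i) (hd' j)).ne'
    rw [show ∀ X Y c D : ℝ, c / D * (D * X + -ε * (D * Y)) = (c / D * D) * (X - ε * Y) by
      intros; ring, div_mul_cancel₀ _ hdp]
    linear_combination h1 - ε * h2 +
      frobInner (x.2 * (diagonal (fun i : Fin p => sv A i) * Ω * diagonal μ)) θ.2 * hε

/-- Eigenvalues of the Hessian for rotations towards the next singular pair. -/
theorem hasEigenvalue_next (hσ : ∀ i < p, sv A (i + 1) < sv A i) (hpmn : p < min m n)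
    (hx : IsLeadingSingularPair A x)
    (hd : ∀ ξ : Ambient m n p, ξ ≠ 0 → 0 < weightedForm (diagonal d, diagonal d) ξ ξ)
    (hd' : ∀ i, 0 < d i)
    (hH : ∀ η θ : tangent x, weightedForm (diagonal d, diagonal d) (H η : Ambient m n p)
      (θ : Ambient m n p) = hessForm A μ η θ) (i : Fin p) {ε : ℝ} (hε : ε * ε = 1) :
    H.HasEigenvalue (μ i * (sv A i + ε * sv A p) / d i) := by
  obtain ⟨u, v, hu, hUu, hVv, hAv, hAu⟩ := (exists_next_singular_pair hσ hpmn hx).2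
  have hmem : ∀ {a : ℕ} {W : Matrix (Fin a) (Fin p) ℝ} {w : Fin a → ℝ}, Wᵀ *ᵥ w = 0 →
      vecMulVec w (Pi.single i 1) ∈ stiefelTangent W := by
    intro a W w hw
    have h1 : Wᵀ * vecMulVec w (Pi.single i 1) = 0 := by
      rw [mul_vecMulVec, hw]; simp
    have h2 := congrArg transpose h1
    rw [transpose_mul, transpose_transpose, transpose_zero] at h2
    rw [mem_stiefelTangent, h1, h2, add_zero]
  have hdiag : ∀ {a : ℕ} (w : Fin a → ℝ) (e : Fin p → ℝ),
      vecMulVec w (Pi.single i 1) * diagonal e = e i • vecMulVec w (Pi.single i 1) := by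
    intro a w e
    ext k l
    rw [mul_diagonal]
    by_cases h : l = i
    · subst h; simp [vecMulVec_apply, mul_comm]
    · simp [vecMulVec_apply, h]
  have e1 : A * vecMulVec v (Pi.single i 1) = sv A p • vecMulVec u (Pi.single i 1) := by
    rw [mul_vecMulVec, hAv, smul_vecMulVec]
  have e2 : Aᵀ * vecMulVec u (Pi.single i 1) = sv A p • vecMulVec v (Pi.single i 1) := by
    rw [mul_vecMulVec, hAu, smul_vecMulVec]
  -- Column `i` is moved towards the next singular pair: with opposite signs for `ε = 1`, with the
  -- same sign for `ε = -1`.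
  refine hasEigenvalue_of_form hd hH
    (η := (vecMulVec u (Pi.single i 1), (-ε) • vecMulVec v (Pi.single i 1)))
    ⟨hmem hUu, Submodule.smul_mem _ _ (hmem hVv)⟩ ?_ ?_
  · intro h
    apply hu
    have h1 : vecMulVec u (Pi.single i 1) = 0 := congrArg Prod.fst h
    ext k
    have := congrFun (congrFun h1 k) i
    simpa [vecMulVec_apply] using this
  · intro θ _
    rw [weightedForm_diagonal_apply, hessForm]
    simp only
    rw [Matrix.mul_smul, e1, e2]
    simp only [Matrix.smul_mul, hdiag, frobInner_smul_left]
    have hdp : d i ≠ 0 := (hd' i).ne'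
    field_simp
    linear_combination (sv A p * μ i * frobInner (vecMulVec v (Pi.single i 1)) θ.2) * hε

end Eigenvalues

end Spectrum

/-! ### The condition number for diagonal weights. -/

section ConditionNumber

variable {p : ℕ}

/-- The candidates for the largest eigenvalue of the Hessian, for the metric with weights `d`. -/
def upperCandidates (μ σ : Fin p → ℝ) (s : ℝ) (d : Fin p → ℝ) : Set ℝ :=
  {t | ∃ i j : Fin p, i ≠ j ∧ t = (μ i + μ j) * (σ i + σ j) / (d i + d j)} ∪
    {t | ∃ i : Fin p, t = μ i * (σ i + s) / d i}

/-- The candidates for the smallest eigenvalue of the Hessian, for the metric with weights `d`. -/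
def lowerCandidates (μ σ : Fin p → ℝ) (s : ℝ) (d : Fin p → ℝ) : Set ℝ :=
  {t | ∃ i j : Fin p, i ≠ j ∧ t = (μ i - μ j) * (σ i - σ j) / (d i + d j)} ∪
    {t | ∃ i : Fin p, t = μ i * (σ i - s) / d i}

theorem finite_pairs_union (F : Fin p → Fin p → ℝ) (G : Fin p → ℝ) :
    ({t | ∃ i j : Fin p, i ≠ j ∧ t = F i j} ∪ {t | ∃ i, t = G i}).Finite := by
  refine Set.Finite.union ((Set.finite_range fun q : Fin p × Fin p => F q.1 q.2).subset ?_)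
    ((Set.finite_range G).subset ?_)
  · rintro t ⟨i, j, -, rfl⟩
    exact ⟨(i, j), rfl⟩
  · rintro t ⟨i, rfl⟩
    exact ⟨i, rfl⟩

variable {μ σ d : Fin p → ℝ} {s : ℝ}

theorem upperCandidates_finite : (upperCandidates μ σ s d).Finite :=
  finite_pairs_union (fun i j => (μ i + μ j) * (σ i + σ j) / (d i + d j)) _

theorem lowerCandidates_finite : (lowerCandidates μ σ s d).Finite :=
  finite_pairs_union (fun i j => (μ i - μ j) * (σ i - σ j) / (d i + d j)) _

theorem sSup_upperCandidates_mem (hp : 1 ≤ p) :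
    sSup (upperCandidates μ σ s d) ∈ upperCandidates μ σ s d :=
  Set.Nonempty.csSup_mem ⟨_, Or.inr ⟨⟨0, hp⟩, rfl⟩⟩ upperCandidates_finite

theorem sInf_lowerCandidates_mem (hp : 1 ≤ p) :
    sInf (lowerCandidates μ σ s d) ∈ lowerCandidates μ σ s d :=
  Set.Nonempty.csInf_mem ⟨_, Or.inr ⟨⟨0, hp⟩, rfl⟩⟩ lowerCandidates_finite

theorem le_sSup_upperCandidates_pair {i j : Fin p} (hij : i ≠ j) :
    (μ i + μ j) * (σ i + σ j) / (d i + d j) ≤ sSup (upperCandidates μ σ s d) :=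
  le_csSup upperCandidates_finite.bddAbove (Or.inl ⟨i, j, hij, rfl⟩)

theorem le_sSup_upperCandidates_single (i : Fin p) :
    μ i * (σ i + s) / d i ≤ sSup (upperCandidates μ σ s d) :=
  le_csSup upperCandidates_finite.bddAbove (Or.inr ⟨i, rfl⟩)

theorem sInf_lowerCandidates_le_pair {i j : Fin p} (hij : i ≠ j) :
    sInf (lowerCandidates μ σ s d) ≤ (μ i - μ j) * (σ i - σ j) / (d i + d j) :=
  csInf_le lowerCandidates_finite.bddBelow (Or.inl ⟨i, j, hij, rfl⟩)

theorem sInf_lowerCandidates_le_single (i : Fin p) :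
    sInf (lowerCandidates μ σ s d) ≤ μ i * (σ i - s) / d i :=
  csInf_le lowerCandidates_finite.bddBelow (Or.inr ⟨i, rfl⟩)

/-- The condition number of the Hessian for the metric with diagonal weights. -/
theorem conditionNumber_eq {m n : ℕ} (hp : 1 ≤ p) {A : Matrix (Fin m) (Fin n) ℝ}
    (hσ : ∀ i < p, sv A (i + 1) < sv A i) (hpmn : p < min m n) (hμ_pos : ∀ i, 0 < μ i)
    {x : Ambient m n p} (hx : IsLeadingSingularPair A x) {H : Module.End ℝ (tangent x)}
    (hd : ∀ ξ : Ambient m n p, ξ ≠ 0 → 0 < weightedForm (diagonal d, diagonal d) ξ ξ)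
    (hd' : ∀ i, 0 < d i)
    (hH : ∀ η θ : tangent x, weightedForm (diagonal d, diagonal d) (H η : Ambient m n p)
      (θ : Ambient m n p) = hessForm A μ η θ) :
    conditionNumber H = sSup (upperCandidates μ (fun i => sv A i) (sv A p) d) /
      sInf (lowerCandidates μ (fun i => sv A i) (sv A p) d) := by
  set L := sSup (upperCandidates μ (fun i => sv A i) (sv A p) d) with hL
  set l := sInf (lowerCandidates μ (fun i => sv A i) (sv A p) d) with hl
  -- An eigenvalue is the Rayleigh quotient of its eigenvector, so bounds on the quadratic form
  -- suffice and no diagonalisation is needed.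
  have hray : ∀ c, H.HasEigenvalue c → ∃ η : Ambient m n p, η ∈ tangent x ∧
      0 < weightedForm (diagonal d, diagonal d) η η ∧
      hessForm A μ η η = c * weightedForm (diagonal d, diagonal d) η η := by
    intro c hc
    obtain ⟨η, hη⟩ := hc.exists_hasEigenvector
    refine ⟨η, η.2, hd _ fun h => hη.2 (Subtype.ext h), ?_⟩
    rw [← hH η η, hη.apply_eq_smul, Submodule.coe_smul, map_smul, LinearMap.smul_apply, smul_eq_mul]
  have hgr : IsGreatest {c : ℝ | H.HasEigenvalue c} L := by
    constructor
    · rcases sSup_upperCandidates_mem (μ := μ) (σ := fun i : Fin p => sv A i) (s := sv A p)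
        (d := d) hp with ⟨i, j, hij, h⟩ | ⟨i, h⟩
      · have := hasEigenvalue_rotation hx hd hd' hH hij (ε := 1) (by norm_num)
        rw [Set.mem_ofPred_eq, hL, h]
        convert! this using 2
        ring
      · have := hasEigenvalue_next hσ hpmn hx hd hd' hH i (ε := 1) (by norm_num)
        rw [Set.mem_ofPred_eq, hL, h]
        convert! this using 4
        ring
    · intro c hc
      obtain ⟨η, hη, hpos, hc⟩ := hray c hc
      -- `r = L`, `ε = -1` says that the Rayleigh quotient is at most `L`; below, `r = -l`, `ε = 1`
      -- gives the lower bound.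
      have := weightedForm_add_hessForm_nonneg hσ hpmn (μ := μ) hx (d := d) (r := L) (ε := -1)
        (fun i j hij => by
          have h1 := le_sSup_upperCandidates_pair (μ := μ) (σ := fun i : Fin p => sv A i)
            (s := sv A p) (d := d) hij
          rw [div_le_iff₀ (add_pos (hd' i) (hd' j)), ← hL] at h1
          have h2 : 0 ≤ sv A i * μ j + sv A j * μ i :=
            add_nonneg (mul_nonneg (sv_nonneg A i) (hμ_pos j).le)
              (mul_nonneg (sv_nonneg A j) (hμ_pos i).le)
          rw [neg_one_mul, abs_neg, abs_of_nonneg h2]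
          linarith)
        (fun i => by
          have h1 := le_sSup_upperCandidates_single (μ := μ) (σ := fun i : Fin p => sv A i)
            (s := sv A p) (d := d) i
          rw [div_le_iff₀ (hd' i), ← hL] at h1
          rw [neg_one_mul, abs_neg, abs_of_pos (hμ_pos i)]
          linarith) hη
      rw [hc] at this
      refine le_of_mul_le_mul_right ?_ hpos
      linarith
  have hle : IsLeast {c : ℝ | H.HasEigenvalue c} l := by
    constructor
    · rcases sInf_lowerCandidates_mem (μ := μ) (σ := fun i : Fin p => sv A i) (s := sv A p)
        (d := d) hp with ⟨i, j, hij, h⟩ | ⟨i, h⟩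
      · have := hasEigenvalue_rotation hx hd hd' hH hij (ε := -1) (by norm_num)
        rw [Set.mem_ofPred_eq, hl, h]
        convert! this using 2
        ring
      · have := hasEigenvalue_next hσ hpmn hx hd hd' hH i (ε := -1) (by norm_num)
        rw [Set.mem_ofPred_eq, hl, h]
        convert! this using 3
        ring
    · intro c hc
      obtain ⟨η, hη, hpos, hc⟩ := hray c hc
      have := weightedForm_add_hessForm_nonneg hσ hpmn (μ := μ) hx (d := d) (r := -l) (ε := 1)
        (fun i j hij => by
          have h1 := sInf_lowerCandidates_le_pair (μ := μ) (σ := fun i : Fin p => sv A i)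
            (s := sv A p) (d := d) hij
          rw [le_div_iff₀ (add_pos (hd' i) (hd' j)), ← hl] at h1
          have h2 : 0 ≤ sv A i * μ j + sv A j * μ i :=
            add_nonneg (mul_nonneg (sv_nonneg A i) (hμ_pos j).le)
              (mul_nonneg (sv_nonneg A j) (hμ_pos i).le)
          rw [one_mul, abs_of_nonneg h2]
          linarith)
        (fun i => by
          have h1 := sInf_lowerCandidates_le_single (μ := μ) (σ := fun i : Fin p => sv A i)
            (s := sv A p) (d := d) i
          rw [le_div_iff₀ (hd' i), ← hl] at h1
          rw [one_mul, abs_of_pos (hμ_pos i)]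
          linarith) hη
      rw [hc] at this
      refine le_of_mul_le_mul_right ?_ hpos
      linarith
  rw [conditionNumber, hgr.csSup_eq, hle.csInf_eq]

/-! ### Comparison of the two condition numbers -/

theorem sinh_add_sinh_eq (a b : ℝ) :
    Real.sinh a + Real.sinh b = 2 * (Real.sinh ((a + b) / 2) * Real.cosh ((a - b) / 2)) := by
  have h1 := Real.sinh_add ((a + b) / 2) ((a - b) / 2)
  have h2 := Real.sinh_sub ((a + b) / 2) ((a - b) / 2)
  rw [show (a + b) / 2 + (a - b) / 2 = a by ring] at h1
  rw [show (a + b) / 2 - (a - b) / 2 = b by ring] at h2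
  rw [h1, h2]
  ring

theorem cosh_add_cosh_eq (a b : ℝ) :
    Real.cosh a + Real.cosh b = 2 * (Real.cosh ((a + b) / 2) * Real.cosh ((a - b) / 2)) := by
  have h1 := Real.cosh_add ((a + b) / 2) ((a - b) / 2)
  have h2 := Real.cosh_sub ((a + b) / 2) ((a - b) / 2)
  rw [show (a + b) / 2 + (a - b) / 2 = a by ring] at h1
  rw [show (a + b) / 2 - (a - b) / 2 = b by ring] at h2
  rw [h1, h2]
  ring

/-- The quotient `(sinh a + sinh b)/(cosh a + cosh b)` is `tanh ((a + b)/2)`, increasing in `a + b`.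
Cross-multiplied, the difference is a multiple of `sinh` of half the gap. -/
theorem sinh_mul_cosh_le {a b a' b' : ℝ} (h : a + b ≤ a' + b') :
    (Real.sinh a + Real.sinh b) * (Real.cosh a' + Real.cosh b') ≤
      (Real.sinh a' + Real.sinh b') * (Real.cosh a + Real.cosh b) := by
  rw [sinh_add_sinh_eq a b, sinh_add_sinh_eq a' b', cosh_add_cosh_eq a b, cosh_add_cosh_eq a' b']
  have h1 : 0 ≤ Real.sinh ((a' + b') / 2 - (a + b) / 2) :=
    Real.sinh_nonneg_iff.2 (by linarith)
  rw [Real.sinh_sub] at h1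
  have h2 : 0 ≤ Real.cosh ((a - b) / 2) * Real.cosh ((a' - b') / 2) :=
    mul_nonneg (Real.cosh_pos _).le (Real.cosh_pos _).le
  have := mul_nonneg h1 h2
  linarith

theorem cosh_add_cosh_le {a b a' b' : ℝ} (h : |a + b| ≤ |a' + b'|) (h' : |a - b| ≤ |a' - b'|) :
    Real.cosh a + Real.cosh b ≤ Real.cosh a' + Real.cosh b' := by
  rw [cosh_add_cosh_eq a b, cosh_add_cosh_eq a' b']
  have h1 : Real.cosh ((a + b) / 2) ≤ Real.cosh ((a' + b') / 2) := by
    rw [Real.cosh_le_cosh, abs_div, abs_div]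
    gcongr
  have h2 : Real.cosh ((a - b) / 2) ≤ Real.cosh ((a' - b') / 2) := by
    rw [Real.cosh_le_cosh, abs_div, abs_div]
    gcongr
  have := (Real.cosh_pos ((a + b) / 2)).le
  have := (Real.cosh_pos ((a - b) / 2)).le
  have := (Real.cosh_pos ((a' + b') / 2)).le
  gcongr

/-- The regularised weights `m = √(t² + δ)` for a decreasing positive sequence `t`, compared at a
pair `i < j` and at a pair of neighbours `k < l`. -/
theorem regularized_weights_compare {δ : ℝ} (hδ : 0 < δ) {t : Fin p → ℝ} (ht : StrictAnti t)
    (ht0 : ∀ i, 0 < t i) :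
    (∀ i j, i ≤ j → √(t j ^ 2 + δ) ≤ √(t i ^ 2 + δ)) ∧
    (∀ i k l, k ≤ i → l ≤ i → 2 * t i * (√(t k ^ 2 + δ) + √(t l ^ 2 + δ)) ≤
      (t k + t l) * (2 * √(t i ^ 2 + δ))) ∧
    (∀ i j k l, i < j → k < l → (∀ q, q ≤ k ∨ l ≤ q) →
      √(t k ^ 2 + δ) + √(t l ^ 2 + δ) ≤ √(t i ^ 2 + δ) + √(t j ^ 2 + δ) ∨
      (t i + t j) * (√(t k ^ 2 + δ) + √(t l ^ 2 + δ)) ≤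
        (t k + t l) * (√(t i ^ 2 + δ) + √(t j ^ 2 + δ))) := by
  have hδ' : 0 < √δ := Real.sqrt_pos.2 hδ
  -- Hyperbolic coordinates: `t = √δ sinh y` makes `√(t² + δ) = √δ cosh y`.
  obtain ⟨y, hy⟩ : ∃ y : Fin p → ℝ, y = fun i => Real.arsinh (t i / √δ) := ⟨_, rfl⟩
  have hyt : ∀ i, t i = √δ * Real.sinh (y i) := by
    intro i
    rw [hy]
    simp only [Real.sinh_arsinh]
    field_simp
  have hym : ∀ i, √(t i ^ 2 + δ) = √δ * Real.cosh (y i) := by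
    intro i
    rw [hyt, mul_pow, Real.sq_sqrt hδ.le, Real.sinh_sq,
      show δ * (Real.cosh (y i) ^ 2 - 1) + δ = δ * Real.cosh (y i) ^ 2 by ring,
      Real.sqrt_mul hδ.le, Real.sqrt_sq (Real.cosh_pos _).le]
  have hya : StrictAnti y := by
    intro i j hij
    rw [hy]
    exact Real.arsinh_lt_arsinh.2 (div_lt_div_of_pos_right (ht hij) hδ')
  have hy0 : ∀ i, 0 < y i := by
    intro i
    rw [hy]
    exact Real.arsinh_pos_iff.2 (div_pos (ht0 i) hδ')
  have hmono : ∀ i j, i ≤ j → √(t j ^ 2 + δ) ≤ √(t i ^ 2 + δ) := by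
    intro i j hij
    have := ht.antitone hij
    have := (ht0 j).le
    gcongr
  refine ⟨hmono, fun i k l hk hl => ?_, fun i j k l hij hkl hadj => ?_⟩
  · have h := sinh_mul_cosh_le (a := y i) (b := y i) (a' := y k) (b' := y l)
      (add_le_add (hya.antitone hk) (hya.antitone hl))
    rw [hym, hym, hym, hyt i, hyt k, hyt l]
    have := mul_le_mul_of_nonneg_left h (mul_pos hδ' hδ').le
    linarith
  · by_cases h1 : y i + y j ≤ y k + y l
    · right
      have h := sinh_mul_cosh_le h1
      rw [hym, hym, hym, hym, hyt i, hyt k, hyt l, hyt j]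
      have := mul_le_mul_of_nonneg_left h (mul_pos hδ' hδ').le
      linarith
    · left
      push Not at h1
      by_cases h2 : y k - y l ≤ y i - y j
      · rw [hym, hym, hym, hym, ← mul_add, ← mul_add]
        refine mul_le_mul_of_nonneg_left (cosh_add_cosh_le ?_ ?_) hδ'.le
        · rw [abs_of_pos (add_pos (hy0 k) (hy0 l)), abs_of_pos (add_pos (hy0 i) (hy0 j))]
          exact h1.le
        · rw [abs_of_pos (sub_pos.2 (hya hkl)), abs_of_pos (sub_pos.2 (hya hij))]
          exact h2
      -- The two failed comparisons add up to `y j > y l`. As `k`, `l` are neighbours, `i < j ≤ k <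
      -- l`, and the weights decrease along the index.
      · have h3 : j < l := hya.lt_iff_gt.1 (by linarith)
        have h4 : j ≤ k := (hadj j).resolve_right (not_le.2 h3)
        exact add_le_add (hmono _ _ (hij.le.trans h4)) (hmono _ _ (h4.trans hkl.le))

/-- The regularised weights do not increase the condition number. -/
theorem condition_number_le (hp : 1 ≤ p) {δ : ℝ} (hδ : 0 < δ) (hμ : StrictAnti μ)
    (hμ_pos : ∀ i, 0 < μ i) (hσ : StrictAnti σ) (hs : 0 ≤ s) (hsσ : ∀ i, s < σ i)
    (hd : ∀ i, d i = √(μ i ^ 2 * σ i ^ 2 + δ)) :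
    sSup (upperCandidates μ σ s d) / sInf (lowerCandidates μ σ s d) ≤
      sSup (upperCandidates μ σ s 1) / sInf (lowerCandidates μ σ s 1) := by
  have hσ_pos : ∀ i, 0 < σ i := fun i => hs.trans_lt (hsσ i)
  have hd_pos : ∀ i, 0 < d i := fun i => by
    rw [hd]
    exact Real.sqrt_pos.2 (by positivity)
  obtain ⟨t, ht⟩ : ∃ t : Fin p → ℝ, ∀ i, t i = μ i * σ i := ⟨_, fun _ => rfl⟩
  have hdt : ∀ i, √(t i ^ 2 + δ) = d i := fun i => by rw [hd, ht, mul_pow]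
  have ht_pos : ∀ i, 0 < t i := fun i => by rw [ht]; exact mul_pos (hμ_pos i) (hσ_pos i)
  have ht_anti : StrictAnti t := by
    intro i j hij
    rw [ht, ht]
    exact mul_lt_mul'' (hμ hij) (hσ hij) (hμ_pos j).le (hσ_pos j).le
  obtain ⟨hw1, hw2, hw3⟩ := regularized_weights_compare hδ ht_anti ht_pos
  simp only [hdt] at hw1 hw2 hw3
  have hBpos : ∀ i j, i ≠ j → 0 < (μ i - μ j) * (σ i - σ j) := by
    intro i j hij
    rcases lt_or_gt_of_ne hij with h | h
    · exact mul_pos (sub_pos.2 (hμ h)) (sub_pos.2 (hσ h))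
    · exact mul_pos_of_neg_of_neg (sub_neg.2 (hμ h)) (sub_neg.2 (hσ h))
  have hBpos' : ∀ i, 0 < μ i * (σ i - s) := fun i => mul_pos (hμ_pos i) (sub_pos.2 (hsσ i))
  have hinf_pos : ∀ e : Fin p → ℝ, (∀ i, 0 < e i) → 0 < sInf (lowerCandidates μ σ s e) := by
    intro e he
    rcases sInf_lowerCandidates_mem (μ := μ) (σ := σ) (s := s) (d := e) hp with
      ⟨i, j, hij, h⟩ | ⟨i, h⟩
    · rw [h]; exact div_pos (hBpos i j hij) (add_pos (he i) (he j))
    · rw [h]; exact div_pos (hBpos' i) (he i)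
  obtain ⟨M, hM⟩ : ∃ M, M = sSup (upperCandidates μ σ s 1) := ⟨_, rfl⟩
  obtain ⟨ρ, hρ⟩ : ∃ ρ, ρ = sInf (lowerCandidates μ σ s d) := ⟨_, rfl⟩
  have hρ_pos : 0 < ρ := hρ ▸ hinf_pos d hd_pos
  have hMp : ∀ i j, i ≠ j → (μ i + μ j) * (σ i + σ j) ≤ 2 * M := by
    intro i j hij
    have := le_sSup_upperCandidates_pair (μ := μ) (σ := σ) (s := s) (d := 1) hij
    rw [← hM] at this
    simp only [Pi.one_apply] at this
    linarith
  have hMs : ∀ i, μ i * (σ i + s) ≤ M := by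
    intro i
    have := le_sSup_upperCandidates_single (μ := μ) (σ := σ) (s := s) (d := 1) i
    rw [← hM] at this
    simpa using this
  have hM_pos : 0 < M := (mul_pos (hμ_pos ⟨0, hp⟩) (by linarith [hσ_pos ⟨0, hp⟩])).trans_le
    (hMs ⟨0, hp⟩)
  have hρp : ∀ i j, i ≠ j → ρ * (d i + d j) ≤ (μ i - μ j) * (σ i - σ j) := by
    intro i j hij
    have := sInf_lowerCandidates_le_pair (μ := μ) (σ := σ) (s := s) (d := d) hij
    rwa [← hρ, le_div_iff₀ (add_pos (hd_pos i) (hd_pos j))] at this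
  have hρs : ∀ i, ρ * d i ≤ μ i * (σ i - s) := by
    intro i
    have := sInf_lowerCandidates_le_single (μ := μ) (σ := σ) (s := s) (d := d) i
    rwa [← hρ, le_div_iff₀ (hd_pos i)] at this
  -- it suffices to find a scale `c` and a lower candidate `c ρ` of the unweighted problem
  suffices hkey : ∃ c, sInf (lowerCandidates μ σ s 1) ≤ c * ρ ∧
      ∀ a ∈ upperCandidates μ σ s d, c * a ≤ M by
    obtain ⟨c, hc, hca⟩ := hkey
    rw [← hM, ← hρ, div_le_div_iff₀ hρ_pos (hinf_pos 1 fun _ => one_pos)]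
    obtain ⟨a, ha⟩ : ∃ a, a = sSup (upperCandidates μ σ s d) := ⟨_, rfl⟩
    have hmem := sSup_upperCandidates_mem (μ := μ) (σ := σ) (s := s) (d := d) hp
    have h0 : 0 ≤ a := by
      refine le_trans ?_ (ha ▸ le_sSup_upperCandidates_single ⟨0, hp⟩)
      exact div_nonneg (mul_nonneg (hμ_pos _).le (by linarith [hσ_pos ⟨0, hp⟩])) (hd_pos _).le
    rw [← ha] at hmem ⊢
    calc a * sInf (lowerCandidates μ σ s 1) ≤ a * (c * ρ) := mul_le_mul_of_nonneg_left hc h0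
      _ = c * a * ρ := by ring
      _ ≤ M * ρ := mul_le_mul_of_nonneg_right (hca a hmem) hρ_pos.le
  have hpair : ∀ k l, k < l → ρ * (d k + d l) = (μ k - μ l) * (σ k - σ l) →
      ∃ c, sInf (lowerCandidates μ σ s 1) ≤ c * ρ ∧ ∀ a ∈ upperCandidates μ σ s d, c * a ≤ M := by
    intro k l' hkl' hρkl'
    -- the minimum over pairs is attained at neighbours
    obtain ⟨l, hkl, hll', hadj⟩ : ∃ l : Fin p, k < l ∧ l ≤ l' ∧ ∀ q, q ≤ k ∨ l ≤ q := by
      refine ⟨⟨k + 1, lt_of_le_of_lt (Nat.succ_le_of_lt hkl') l'.2⟩, ?_, ?_, fun q => ?_⟩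
      · exact Fin.lt_def.2 (Nat.lt_succ_self _)
      · exact Fin.le_def.2 (Nat.succ_le_of_lt hkl')
      · rcases le_or_gt q k with h | h
        · exact Or.inl h
        · exact Or.inr (Fin.le_def.2 (Nat.succ_le_of_lt h))
    -- Moving `l'` towards `k` shrinks the numerator and enlarges the denominator, so minimality
    -- forces equality.
    have hρkl : ρ * (d k + d l) = (μ k - μ l) * (σ k - σ l) := by
      refine le_antisymm (hρp k l hkl.ne) ?_
      have h1 : (μ k - μ l) * (σ k - σ l) ≤ (μ k - μ l') * (σ k - σ l') :=
        mul_le_mul (sub_le_sub_left (hμ.antitone hll') _) (sub_le_sub_left (hσ.antitone hll') _)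
          (sub_nonneg.2 (hσ hkl).le) (sub_nonneg.2 (hμ (hkl.trans_le hll')).le)
      have h2 := mul_le_mul_of_nonneg_left (add_le_add_right (hw1 _ _ hll') (d k)) hρ_pos.le
      linarith
    -- By `hρkl` the left side is exactly `(μ k + μ l)(σ k + σ l)`.
    have hAkl : (t k + t l) * 2 - ρ * (d k + d l) ≤ 2 * M := by
      have := hMp k l hkl.ne
      rw [hρkl, ht, ht]
      linarith
    have hlt : ∀ i j, i < j →
        (d k + d l) / 2 * ((μ i + μ j) * (σ i + σ j) / (d i + d j)) ≤ M := by
      intro i j hij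
      have hdij := add_pos (hd_pos i) (hd_pos j)
      have hdkl := add_pos (hd_pos k) (hd_pos l)
      rw [← mul_div_assoc, div_le_iff₀ hdij]
      rcases hw3 i j k l hij hkl hadj with h | h
      · have h1 := hMp i j hij.ne
        have h2 : (d k + d l) * ((μ i + μ j) * (σ i + σ j)) ≤ (d i + d j) * (2 * M) := by
          refine mul_le_mul h h1 ?_ hdij.le
          exact mul_nonneg (add_pos (hμ_pos i) (hμ_pos j)).le (add_pos (hσ_pos i) (hσ_pos j)).le
        linarith
      -- Here `(μ i + μ j)(σ i + σ j)/(d i + d j) ≤ 2(t i + t j)/(d i + d j) - ρ ≤ 2(t k + t l)/(d k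
      -- + d l) - ρ ≤ 2M/(d k + d l)`.
      · have h1 := mul_le_mul_of_nonneg_right (hρp i j hij.ne) hdkl.le
        have h2 := mul_le_mul_of_nonneg_right hAkl hdij.le
        have h3 : (μ i + μ j) * (σ i + σ j) =
            2 * (t i + t j) - (μ i - μ j) * (σ i - σ j) := by
          rw [ht, ht]; ring
        rw [h3]
        linarith
    -- With this scale, `c ρ` is exactly the unweighted candidate of the pair `(k, l)`, whose
    -- denominator is `1 + 1`.
    refine ⟨(d k + d l) / 2, ?_, ?_⟩
    · have := sInf_lowerCandidates_le_pair (μ := μ) (σ := σ) (s := s) (d := 1) hkl.ne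
      simp only [Pi.one_apply] at this
      linarith
    · rintro a (⟨i, j, hij, rfl⟩ | ⟨i, rfl⟩)
      · rcases lt_or_gt_of_ne hij with h | h
        · exact hlt i j h
        · have := hlt j i h
          rwa [add_comm (μ i), add_comm (σ i), add_comm (d i)]
      · rw [← mul_div_assoc, div_le_iff₀ (hd_pos i)]
        have hA0 : 0 ≤ μ i * (σ i + s) := mul_nonneg (hμ_pos i).le (by linarith [hσ_pos i])
        rcases hadj i with h | h
        · have h1 := hw1 _ _ h
          have h2 := hw1 _ _ (h.trans hkl.le)
          have h3 : (d k + d l) / 2 * (μ i * (σ i + s)) ≤ d i * M :=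
            mul_le_mul (by linarith) (hMs i) hA0 (hd_pos i).le
          linarith
        · have h1 := hw2 i k l (hkl.le.trans h) h
          have h2 := mul_le_mul_of_nonneg_right (hρs i) (add_pos (hd_pos k) (hd_pos l)).le
          have h3 := mul_le_mul_of_nonneg_right hAkl (hd_pos i).le
          have h4 : μ i * (σ i + s) = 2 * t i - μ i * (σ i - s) := by rw [ht]; ring
          rw [h4]
          linarith
  rcases sInf_lowerCandidates_mem (μ := μ) (σ := σ) (s := s) (d := d) hp with
    ⟨k, l, hkl, h⟩ | ⟨k, h⟩
  · rw [← hρ, eq_div_iff (add_pos (hd_pos k) (hd_pos l)).ne'] at h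
    rcases lt_or_gt_of_ne hkl with h1 | h1
    · exact hpair k l h1 h
    · exact hpair l k h1 (by rw [add_comm, h]; ring)
  · rw [← hρ, eq_div_iff (hd_pos k).ne'] at h
    -- the minimum over single indices is attained at the last one
    obtain ⟨z, hz⟩ : ∃ z : Fin p, ∀ i, i ≤ z :=
      ⟨⟨p - 1, by omega⟩, fun i => Fin.le_def.2 (Nat.le_sub_one_of_lt i.2)⟩
    -- The candidate is `(t/d)(1 - s/σ)`, and both factors decrease along the index.
    have hz' : μ z * (σ z - s) ≤ ρ * d z := by
      have h1 := hw2 z k k (hz k) (hz k)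
      have h2 : t z * d k ≤ t k * d z := by linarith
      rw [ht, ht] at h2
      have h3 : (σ z - s) * σ k ≤ (σ k - s) * σ z := by
        have := mul_le_mul_of_nonneg_left (hσ.antitone (hz k)) hs
        linarith
      have h4 := mul_le_mul_of_nonneg_right h2
        (mul_nonneg (sub_pos.2 (hsσ z)).le (hσ_pos k).le)
      have h5 := mul_le_mul_of_nonneg_left h3
        (mul_nonneg (mul_nonneg (hμ_pos k).le (hσ_pos k).le) (hd_pos z).le)
      have h6 : μ z * (σ z - s) * d k ≤ μ k * (σ k - s) * d z := by
        refine le_of_mul_le_mul_right ?_ (mul_pos (hσ_pos z) (hσ_pos k))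
        linarith
      rw [← h] at h6
      refine le_of_mul_le_mul_right ?_ (hd_pos k)
      linarith
    -- `d z` is the smallest weight, so each rescaled upper candidate is at most its unweighted
    -- counterpart.
    refine ⟨d z, ?_, ?_⟩
    · have := sInf_lowerCandidates_le_single (μ := μ) (σ := σ) (s := s) (d := 1) z
      simp only [Pi.one_apply, div_one] at this
      linarith
    · rintro a (⟨i, j, hij, rfl⟩ | ⟨i, rfl⟩)
      · rw [← mul_div_assoc, div_le_iff₀ (add_pos (hd_pos i) (hd_pos j))]
        have h1 := hw1 _ _ (hz i)
        have h2 := hw1 _ _ (hz j)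
        have h3 : d z * ((μ i + μ j) * (σ i + σ j)) ≤ (d i + d j) / 2 * (2 * M) :=
          mul_le_mul (by linarith) (hMp i j hij)
            (mul_nonneg (add_pos (hμ_pos i) (hμ_pos j)).le (add_pos (hσ_pos i) (hσ_pos j)).le)
            (by linarith [hd_pos i, hd_pos j])
        linarith
      · rw [← mul_div_assoc, div_le_iff₀ (hd_pos i), mul_comm M]
        exact mul_le_mul (hw1 _ _ (hz i)) (hMs i)
          (mul_nonneg (hμ_pos i).le (by linarith [hσ_pos i])) (hd_pos i).le

end ConditionNumber

/-! ### Specialisation to the two metrics and to the closed forms. -/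

section Conclusion

variable {m n p : ℕ}

theorem weightedForm_pos {S : Matrix (Fin p) (Fin p) ℝ × Matrix (Fin p) (Fin p) ℝ}
    (h₁ : ∀ ξ : Matrix (Fin m) (Fin p) ℝ, ξ ≠ 0 → 0 < frobInner ξ (ξ * S.1))
    (h₂ : ∀ ξ : Matrix (Fin n) (Fin p) ℝ, ξ ≠ 0 → 0 < frobInner ξ (ξ * S.2))
    {ξ : Ambient m n p} (hξ : ξ ≠ 0) : 0 < weightedForm S ξ ξ := by
  rw [weightedForm_apply]
  by_cases h : ξ.1 = 0
  · have h' : ξ.2 ≠ 0 := fun h' => hξ (Prod.ext h h')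
    have h0 : frobInner ξ.1 (ξ.1 * S.1) = 0 := by rw [h]; simp [frobInner]
    rw [h0, zero_add]
    exact h₂ _ h'
  · by_cases h' : ξ.2 = 0
    · have h0 : frobInner ξ.2 (ξ.2 * S.2) = 0 := by rw [h']; simp [frobInner]
      rw [h0, add_zero]
      exact h₁ _ h
    · exact add_pos (h₁ _ h) (h₂ _ h')

/-- The Euclidean Hessian and its condition number. -/
theorem euclideanHess_spec {A : Matrix (Fin m) (Fin n) ℝ} (hp : 1 ≤ p) (hpmn : p < min m n)
    (hσ : ∀ i < p, sv A (i + 1) < sv A i) {μ : Fin p → ℝ} (hμ_pos : ∀ i, 0 < μ i)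
    {x : Ambient m n p} (hx : IsLeadingSingularPair A x) :
    (∃! H, IsRiemannianHessian (stiefelProd m n p) tangent euclideanMetric (cost A μ) x H) ∧
    conditionNumber (euclideanHess A μ x) =
      sSup (upperCandidates μ (fun i => sv A i) (sv A p) 1) /
        sInf (lowerCandidates μ (fun i => sv A i) (sv A p) 1) := by
  have hm : (fun y ξ θ : Ambient m n p => weightedForm (1, 1) ξ θ) = euclideanMetric := by
    funext y ξ θ
    simp [weightedForm_apply, euclideanMetric]
  have hpos : ∀ ξ : Ambient m n p, ξ ≠ 0 → 0 < weightedForm (1, 1) ξ ξ := fun ξ hξ =>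
    weightedForm_pos (fun ζ hζ => by simpa using frobInner_self_pos hζ)
      (fun ζ hζ => by simpa using frobInner_self_pos hζ) hξ
  have h := riemannianHessian_cost (μ := μ) hx (S := fun _ => (1, 1)) continuous_const
    (fun _ => hpos)
  have h1 : (1, 1) = ((diagonal 1, diagonal 1) :
      Matrix (Fin p) (Fin p) ℝ × Matrix (Fin p) (Fin p) ℝ) := by
    rw [show diagonal (1 : Fin p → ℝ) = 1 from diagonal_one]
  simp only [hm] at h
  refine ⟨h.1, conditionNumber_eq hp hσ hpmn hμ_pos hx (h1 ▸ hpos) (fun _ => one_pos) ?_⟩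
  rw [← h1]
  exact h.2

/-- The Hessian for the preconditioned metric and its condition number. -/
theorem newHess_spec {A : Matrix (Fin m) (Fin n) ℝ} (hp : 1 ≤ p) (hpmn : p < min m n)
    (hσ : ∀ i < p, sv A (i + 1) < sv A i) {μ : Fin p → ℝ} (hμ_pos : ∀ i, 0 < μ i)
    {x : Ambient m n p} (hx : IsLeadingSingularPair A x) {δ : ℝ} (hδ : 0 < δ) :
    (∃! H, IsRiemannianHessian (stiefelProd m n p) tangent (newMetric A μ δ) (cost A μ) x H) ∧
    conditionNumber (newHess A μ δ x) =
      sSup (upperCandidates μ (fun i => sv A i) (sv A p)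
        fun i => √(μ i ^ 2 * sv A i ^ 2 + δ)) /
      sInf (lowerCandidates μ (fun i => sv A i) (sv A p)
        fun i => √(μ i ^ 2 * sv A i ^ 2 + δ)) := by
  obtain ⟨S, hS⟩ : ∃ S : Ambient m n p → Matrix (Fin p) (Fin p) ℝ × Matrix (Fin p) (Fin p) ℝ,
      S = fun y => (regAbs δ (y.1ᵀ * A * y.2 * diagonal μ),
        regAbs δ (y.2ᵀ * Aᵀ * y.1 * diagonal μ)) := ⟨_, rfl⟩
  have hm : (fun y ξ θ : Ambient m n p => weightedForm (S y) ξ θ) = newMetric A μ δ := by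
    rw [hS]
    rfl
  have hpos : ∀ y (ξ : Ambient m n p), ξ ≠ 0 → 0 < weightedForm (S y) ξ ξ := by
    intro y ξ hξ
    refine weightedForm_pos (S := S y) (fun ζ hζ => ?_) (fun ζ hζ => ?_) hξ <;>
    · rw [hS]
      exact frobInner_mul_regAbs_pos hδ _ hζ
  have hc₁ : Continuous fun y : Ambient m n p => y.1ᵀ * A * y.2 * diagonal μ :=
    ((continuous_fst.matrix_transpose.matrix_mul continuous_const).matrix_mul
      continuous_snd).matrix_mul continuous_const
  have hc₂ : Continuous fun y : Ambient m n p => y.2ᵀ * Aᵀ * y.1 * diagonal μ :=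
    ((continuous_snd.matrix_transpose.matrix_mul continuous_const).matrix_mul
      continuous_fst).matrix_mul continuous_const
  have hr₁ : Continuous fun y : Ambient m n p => regAbs δ (y.1ᵀ * A * y.2 * diagonal μ) :=
    (continuous_regAbs hδ).comp hc₁
  have hr₂ : Continuous fun y : Ambient m n p => regAbs δ (y.2ᵀ * Aᵀ * y.1 * diagonal μ) :=
    (continuous_regAbs hδ).comp hc₂
  have hSc : Continuous S := by
    rw [hS]
    exact hr₁.prodMk hr₂
  have h := riemannianHessian_cost (μ := μ) hx hSc hpos
  have hSx : S x = (diagonal fun i => √(μ i ^ 2 * sv A i ^ 2 + δ),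
      diagonal fun i => √(μ i ^ 2 * sv A i ^ 2 + δ)) := by
    obtain ⟨hU, hV, hAV, hAU⟩ := hx
    rw [hS]
    simp only
    rw [Matrix.mul_assoc x.1ᵀ, hAV, ← Matrix.mul_assoc x.1ᵀ, hU, Matrix.one_mul,
      Matrix.mul_assoc x.2ᵀ, hAU, ← Matrix.mul_assoc x.2ᵀ, hV, Matrix.one_mul,
      diagonal_mul_diagonal, regAbs_diagonal hδ]
    simp only [mul_pow, mul_comm]
  simp only [hm] at h
  refine ⟨h.1, conditionNumber_eq hp hσ hpmn hμ_pos hx (hSx ▸ hpos x) (fun i => ?_) ?_⟩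
  · exact Real.sqrt_pos.2 (by positivity)
  · rw [← hSx]
    exact h.2

theorem sSup_upperCandidates_one {μ : Fin p → ℝ} {σ : ℕ → ℝ} (hp : 1 ≤ p) (hμ : StrictAnti μ)
    (hμ_pos : ∀ i, 0 < μ i) (hσ : Antitone σ) (hσ0 : ∀ i, 0 ≤ σ i) :
    sSup (upperCandidates μ (fun i => σ i) (σ p) 1) =
      max (1 / 2 * (extZero μ 0 + extZero μ 1) * (σ 0 + σ 1)) (extZero μ 0 * (σ 0 + σ p)) := by
  have h0 : extZero μ 0 = μ ⟨0, hp⟩ := by simp [extZero, show 0 < p from hp]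
  have hle0 : ∀ i, μ i ≤ extZero μ 0 := fun i => by
    rw [h0]; exact hμ.antitone (Fin.le_def.2 (Nat.zero_le _))
  refine IsGreatest.csSup_eq ⟨?_, ?_⟩
  · have hR : extZero μ 0 * (σ 0 + σ p) ∈ upperCandidates μ (fun i => σ i) (σ p) 1 :=
      Or.inr ⟨⟨0, hp⟩, by simp [h0]⟩
    rcases le_total (1 / 2 * (extZero μ 0 + extZero μ 1) * (σ 0 + σ 1))
      (extZero μ 0 * (σ 0 + σ p)) with h | h
    · rwa [max_eq_right h]
    · by_cases h1 : 1 < p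
      · rw [max_eq_left h]
        refine Or.inl ⟨⟨0, hp⟩, ⟨1, h1⟩, by simp, ?_⟩
        have : extZero μ 1 = μ ⟨1, h1⟩ := by simp [extZero, h1]
        simp only [Pi.one_apply, h0, this]
        ring
      -- For `p = 1` the pair term is not a candidate; with `μ₂ = 0` and `σ p = σ 1` it is half of
      -- the single term and does not affect the maximum.
      · obtain rfl : p = 1 := by omega
        have h2 : extZero μ 1 = 0 := by simp [extZero]
        have h3 : 1 / 2 * (extZero μ 0 + extZero μ 1) * (σ 0 + σ 1) ≤
            extZero μ 0 * (σ 0 + σ 1) := by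
          have := mul_nonneg ((hμ_pos _).le.trans (hle0 ⟨0, hp⟩)) (add_nonneg (hσ0 0) (hσ0 1))
          rw [h2]
          linarith
        rwa [max_eq_right h3]
  · have hlt : ∀ i j : Fin p, i < j → (μ i + μ j) * (σ i + σ j) / (1 + 1) ≤
        1 / 2 * (extZero μ 0 + extZero μ 1) * (σ 0 + σ 1) := by
      intro i j hij
      have hj : 1 ≤ (j : ℕ) := Nat.one_le_of_lt (Fin.lt_def.1 hij)
      have h1 : extZero μ 1 = μ ⟨1, hj.trans_lt j.2⟩ := by simp [extZero, hj.trans_lt j.2]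
      have h2 : μ j ≤ extZero μ 1 := by rw [h1]; exact hμ.antitone (Fin.le_def.2 hj)
      have h3 : (μ i + μ j) * (σ i + σ j) ≤ (extZero μ 0 + extZero μ 1) * (σ 0 + σ 1) :=
        mul_le_mul (add_le_add (hle0 i) h2) (add_le_add (hσ (Nat.zero_le _)) (hσ hj))
          (add_nonneg (hσ0 _) (hσ0 _))
          (add_nonneg ((hμ_pos i).le.trans (hle0 i)) ((hμ_pos j).le.trans h2))
      linarith
    rintro t (⟨i, j, hij, rfl⟩ | ⟨i, rfl⟩)
    · refine le_trans ?_ (le_max_left _ _)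
      rcases lt_or_gt_of_ne hij with h | h
      · exact hlt i j h
      · simpa only [Pi.one_apply, add_comm] using hlt j i h
    · refine le_trans ?_ (le_max_right _ _)
      rw [Pi.one_apply, div_one]
      exact mul_le_mul (hle0 i) (add_le_add_left (hσ (Nat.zero_le _)) _)
        (add_nonneg (hσ0 _) (hσ0 _)) ((hμ_pos i).le.trans (hle0 i))

/-- The pair candidates agree on both sides. Among the single ones the last index is smallest, both
factors being nonnegative and decreasing. -/
theorem sInf_lowerCandidates_one {μ : Fin p → ℝ} {σ : ℕ → ℝ} (hp : 1 ≤ p) (hμ : StrictAnti μ)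
    (hμ_pos : ∀ i, 0 < μ i) (hσ : Antitone σ) :
    sInf (lowerCandidates μ (fun i => σ i) (σ p) 1) =
      sInf ({t | ∃ i j : Fin p, i ≠ j ∧ t = 1 / 2 * (μ i - μ j) * (σ i - σ j)} ∪
        {extZero μ (p - 1) * (σ (p - 1) - σ p)}) := by
  have hz : extZero μ (p - 1) = μ ⟨p - 1, by omega⟩ := by
    simp [extZero, show 0 < p from hp]
  have hsub : ({t | ∃ i j : Fin p, i ≠ j ∧ t = 1 / 2 * (μ i - μ j) * (σ i - σ j)} ∪
      {extZero μ (p - 1) * (σ (p - 1) - σ p)}) ⊆ lowerCandidates μ (fun i => σ i) (σ p) 1 := by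
    rintro t (⟨i, j, hij, rfl⟩ | rfl)
    · refine Or.inl ⟨i, j, hij, ?_⟩
      simp only [Pi.one_apply]
      ring
    · exact Or.inr ⟨⟨p - 1, by omega⟩, by simp [hz]⟩
  refine le_antisymm (csInf_le_csInf lowerCandidates_finite.bddBelow ⟨_, Or.inr rfl⟩ hsub) ?_
  have hbdd := (lowerCandidates_finite (μ := μ) (σ := fun i => σ i) (s := σ p) (d := 1)).subset
    hsub |>.bddBelow
  refine le_csInf ⟨_, Or.inr ⟨⟨0, hp⟩, rfl⟩⟩ ?_
  rintro t (⟨i, j, hij, rfl⟩ | ⟨i, rfl⟩)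
  · refine csInf_le hbdd (Or.inl ⟨i, j, hij, ?_⟩)
    simp only [Pi.one_apply]
    ring
  · refine (csInf_le hbdd (Or.inr rfl)).trans ?_
    have hi : (i : ℕ) ≤ p - 1 := Nat.le_sub_one_of_lt i.2
    rw [hz, Pi.one_apply, div_one]
    exact mul_le_mul (hμ.antitone (Fin.le_def.2 hi)) (sub_le_sub_right (hσ hi) _)
      (sub_nonneg.2 (hσ (Nat.sub_le _ _))) (hμ_pos i).le

end Conclusion

end TruncatedSVD

open TruncatedSVD in
theorem mainTheorem3 (m n p : ℕ) (hp : 1 ≤ p) (hpmn : p < min m n)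
    (A : Matrix (Fin m) (Fin n) ℝ)
    (hσ : ∀ i < p, sv A (i + 1) < sv A i)
    (μ : Fin p → ℝ) (hμ : StrictAnti μ) (hμ_pos : ∀ i, 0 < μ i)
    (x : Ambient m n p) (hx : IsLeadingSingularPair A x)
    (δ : ℝ) (hδ : 0 < δ) :
    -- both Hessians are well defined
    (∃! H, IsRiemannianHessian (stiefelProd m n p) tangent euclideanMetric (cost A μ) x H) ∧
    (∃! H, IsRiemannianHessian (stiefelProd m n p) tangent (newMetric A μ δ) (cost A μ) x H) ∧
    -- condition number under the Euclidean metric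
    conditionNumber (euclideanHess A μ x) =
      max (1 / 2 * (extZero μ 0 + extZero μ 1) * (sv A 0 + sv A 1)) (extZero μ 0 * (sv A 0 + sv A p)) /
      sInf ({t | ∃ i j : Fin p, i ≠ j ∧ t = 1 / 2 * (μ i - μ j) * (sv A i - sv A j)} ∪
        {extZero μ (p - 1) * (sv A (p - 1) - sv A p)}) ∧
    -- condition number under the new metric
    conditionNumber (newHess A μ δ x) =
      sSup ({t | ∃ i j : Fin p, i ≠ j ∧ t = (μ i + μ j) * (sv A i + sv A j) /
          (√(μ i ^ 2 * sv A i ^ 2 + δ) + √(μ j ^ 2 * sv A j ^ 2 + δ))} ∪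
        {t | ∃ i : Fin p, t = μ i * (sv A i + sv A p) / √(μ i ^ 2 * sv A i ^ 2 + δ)}) /
      sInf ({t | ∃ i j : Fin p, i ≠ j ∧ t = (μ i - μ j) * (sv A i - sv A j) /
          (√(μ i ^ 2 * sv A i ^ 2 + δ) + √(μ j ^ 2 * sv A j ^ 2 + δ))} ∪
        {t | ∃ i : Fin p, t = μ i * (sv A i - sv A p) / √(μ i ^ 2 * sv A i ^ 2 + δ)}) ∧
    -- the new metric does not increase the condition number
    conditionNumber (newHess A μ δ x) ≤ conditionNumber (euclideanHess A μ x) := by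

  have he := euclideanHess_spec hp hpmn hσ hμ_pos hx
  have hn := newHess_spec hp hpmn hσ hμ_pos hx hδ
  refine ⟨he.1, hn.1, ?_, hn.2, ?_⟩
  · rw [he.2, sSup_upperCandidates_one hp hμ hμ_pos (sv_antitone A) (sv_nonneg A),
      sInf_lowerCandidates_one hp hμ hμ_pos (sv_antitone A)]
  · rw [he.2, hn.2]
    refine condition_number_le hp hδ hμ hμ_pos (fun i j hij => ?_) (sv_nonneg A p) (fun i => ?_)
      fun _ => rfl
    · exact (sv_antitone A (Nat.succ_le_of_lt (Fin.lt_def.1 hij))).trans_lt (hσ i i.2)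
    · exact (sv_antitone A (Nat.succ_le_of_lt i.2)).trans_lt (hσ i i.2)
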